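/- All hypergraphs are finite and simple (no repeated edges). A hypergraph is $k$-uniform if every edge has exactly $k$ vertices; its order is its number of vertices. Its adjacency matrix $A$ has zero diagonal, and for $u\ne v$ the entry $A_{uv}$ is the number of edges containing both $u$ and $v$; its Estrada index is $\sum_i e^{\lambda_i}$, where $\lambda_1,\dots,\lambda_n$ are the eigenvalues of $A$ with multiplicity. A cycle of length $m\ge 2$ is a closed sequence $v_1e_1v_2e_2\cdots v_me_mv_1$ of distinct vertices $v_1,\dots,v_m$ and distinct edges $e_1,\dots,e_m$ with $v_i,v_{i+1}\in e_i$ (where $v_{m+1}=v_1$). A hypergraph is unicyclic if it is connected and has exactly one cycle, up to the choice of starting vertex and direction. Let $U(n)$ be the class of $k$-uniform unicyclic hypergraphs of order $n$, up to isomorphism. For $m\ge 2$ and integers $p_1,\dots,p_m\ge 0$, let $C_m(p_1,\dots,p_m)$ be the $k$-uniform hypergraph formed by a cycle $v_1e_1v_2e_2\cdots v_me_mv_1$ with $e_i=\{v_i,v_{i+1},u_{i1},\dots,u_{i(k-2)}\}$ (all $v_i$, $u_{ij}$ distinct) together with, for each $i$, $p_i$ pendant edges attached at $v_i$, that is, edges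 consisting of $v_i$ and $k-1$ new vertices that lie in no other edge. Let $U(m,n)$ be the class of all $C_m(p_1,\dots,p_m)$ of order $n$ that belong to $U(n)$, and let $X_n=C_2\left(\frac{n}{k-1}-2,\,0\right)$. (For $k=2$ there is no simple hypergraph $X_n$, and nothing is excluded below.) **Theorem.** Let $k\ge 2$ and $n>3(k-1)$. If $G_0^*\in U(n)\setminus\{X_n\}$ has the maximum Estrada index among all members of $U(n)\setminus\{X_n\}$, then $G_0^*\in U(m,n)\setminus\{X_n\}$ for some $m\ge 2$ (namely the length of its cycle). -/

import Mathlib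

namespace Hypergraph

/-- All vertices of the ambient type are vertices of `H`; the order of `H` is then the cardinality
of the ambient type. -/
def IsSpanning {V : Type*} (H : Hypergraph V) : Prop := V(H) = Set.univ

/-- Every edge has exactly `k` vertices. -/
def IsUniform {V : Type*} (H : Hypergraph V) (k : ℕ) : Prop := ∀ f ∈ E(H), f.ncard = k

/-- The degree of a vertex: the number of edges containing it. -/
noncomputable def degree {V : Type*} (H : Hypergraph V) (x : V) : ℕ := {f ∈ E(H) | x ∈ f}.ncard

/-- Any two vertices are joined by a walk `v₀ e₁ v₁ … eₛ vₛ` with `vᵢ₋₁, vᵢ ∈ eᵢ`. -/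
def IsConnected {V : Type*} (H : Hypergraph V) : Prop :=
  ∀ x ∈ V(H), ∀ y ∈ V(H), Relation.ReflTransGen H.Adj x y

/-- `v₁ e₁ v₂ e₂ ⋯ vₘ eₘ v₁` is a cycle of length `m ≥ 2` of `H`: distinct vertices, distinct
edges, and `eᵢ` contains `vᵢ` and its cyclic successor `vᵢ₊₁` (`finRotate m i` is the cyclic
successor of `i`). -/
structure IsCycle {V : Type*} (H : Hypergraph V) {m : ℕ} (v : Fin m → V) (e : Fin m → Set V) :
    Prop where
  two_le : 2 ≤ m
  vertex_injective : Function.Injective v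
  edge_injective : Function.Injective e
  edge_mem (i : Fin m) : e i ∈ E(H)
  left_mem (i : Fin m) : v i ∈ e i
  right_mem (i : Fin m) : v (finRotate m i) ∈ e i

/-- The vertex-edge incidences traversed by `v₁ e₁ v₂ e₂ ⋯ vₘ eₘ v₁`. They determine a cycle up to
the choice of its starting vertex and of its direction. -/
def cycleIncidences {V : Type*} {m : ℕ} (v : Fin m → V) (e : Fin m → Set V) : Set (V × Set V) :=
  {p | ∃ i, p = (v i, e i) ∨ p = (v (finRotate m i), e i)}

/-- Connected, with exactly one cycle (up to starting vertex and direction). -/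
def IsUnicyclic {V : Type*} (H : Hypergraph V) : Prop :=
  H.IsConnected ∧
  (∃ (m : ℕ) (v : Fin m → V) (e : Fin m → Set V), H.IsCycle v e) ∧
  ∀ (m m' : ℕ) (v : Fin m → V) (e : Fin m → Set V) (v' : Fin m' → V) (e' : Fin m' → Set V),
    H.IsCycle v e → H.IsCycle v' e' → cycleIncidences v e = cycleIncidences v' e'

/-- `H` is (isomorphic to) `Cₘ(p₁, …, pₘ)`: it consists of a `k`-uniform cycle
`v₁ e₁ v₂ e₂ ⋯ vₘ eₘ v₁`, whose edges are `eᵢ = {vᵢ, vᵢ₊₁, uᵢ₁, …, uᵢ₍ₖ₋₂₎}` with vertices `uᵢⱼ`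
that lie in no other edge, and of pendant edges, `pᵢ` of them attached at `vᵢ`; a pendant edge
attached at `vᵢ` consists of `vᵢ` and `k - 1` vertices that lie in no other edge. -/
def IsCycleWithPendants {V : Type*} (H : Hypergraph V) (k m : ℕ) (p : Fin m → ℕ) : Prop :=
  H.IsSpanning ∧ H.IsUniform k ∧
  ∃ (v : Fin m → V) (e : Fin m → Set V), H.IsCycle v e ∧
    (∀ i, e i ∩ Set.range v = {v i, v (finRotate m i)}) ∧
    (∀ f ∈ E(H), f ∉ Set.range e → ∃ i, f ∩ Set.range v = {v i}) ∧
    (∀ x, x ∉ Set.range v → H.degree x = 1) ∧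
    (∀ i, {f ∈ E(H) | f ∉ Set.range e ∧ v i ∈ f}.ncard = p i)

/-- `U(n)`: the `k`-uniform unicyclic hypergraphs of order `n`, with vertex set `V`. -/
def unicyclicClass (V : Type*) [Fintype V] (k n : ℕ) : Set (Hypergraph V) :=
  {H | H.IsSpanning ∧ Fintype.card V = n ∧ H.IsUniform k ∧ H.IsUnicyclic}

/-- `U(m, n)`: the members of `U(n)` obtained from the `k`-uniform cycle of length `m` by attaching
pendant edges to the vertices `v₁, …, vₘ`. -/
def pendantClass (V : Type*) [Fintype V] (k m n : ℕ) : Set (Hypergraph V) :=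
  {H ∈ unicyclicClass V k n | ∃ p : Fin m → ℕ, H.IsCycleWithPendants k m p}

/-- The members of `U(n)` isomorphic to `Xₙ = C₂(n / (k - 1) - 2, 0)`. -/
def extremalClass (V : Type*) [Fintype V] (k n : ℕ) : Set (Hypergraph V) :=
  {H ∈ unicyclicClass V k n | H.IsCycleWithPendants k 2 ![n / (k - 1) - 2, 0]}

open Classical in
/-- The adjacency matrix: off the diagonal, the number of edges containing both vertices. -/
noncomputable def adjMatrix {V : Type*} (H : Hypergraph V) : Matrix V V ℝ :=
  Matrix.of fun x y => if x = y then 0 else ({f ∈ E(H) | x ∈ f ∧ y ∈ f}.ncard : ℝ)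

theorem adjMatrix_isHermitian {V : Type*} (H : Hypergraph V) : H.adjMatrix.IsHermitian := by
  ext x y
  by_cases h : x = y
  · simp [adjMatrix, h]
  · have h' : ¬ y = x := fun h' => h h'.symm
    simp [adjMatrix, h, h', and_comm]

open Classical in
/-- The Estrada index: the sum of `exp λ` over the eigenvalues `λ` of the adjacency matrix, with
multiplicity. -/
noncomputable def estradaIndex {V : Type*} [Fintype V] (H : Hypergraph V) : ℝ :=
  ∑ i, Real.exp (H.adjMatrix_isHermitian.eigenvalues i)

end Hypergraph

/-! Suppose a vertex `w` off the cycle of a maximiser lay in two edges. Moving edges from `w` to a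
suitable vertex `z` keeps the hypergraph in the class and strictly raises the Estrada index, so by
maximality the result must be `Xₙ`. That determines the hypergraph closely enough to choose another
move which raises the index and does not end at `Xₙ`, a contradiction (`eq_of_mem_of_maximal`).
Hence vertices off the cycle have degree one, and connectivity turns this into the pendant structure
(`isCycleWithPendants_of_forall_eq`).

The index is compared through moments. If, in a common orthonormal basis, `A' + c` dominates the
absolute values of `A + c` entrywise, then all traces of powers compare, and so do the sums of
exponentials. The basis comes from an involution `σ` with `σ w = z`: on each pair `{x, σ x}` take
the antisymmetric and the symmetric combination. Off the diagonal, `A` is the sum over edges of the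
rank-one matrices of their indicators, so the folded entries are sums of products of folded
indicators. A folded indicator can be negative only where an edge contains a point of `R` but not
its mirror image; moving such an edge from `w` to `σ w` flips this sign at `w`. Edges that `σ`
permutes among themselves are left alone (`estradaIndex_lt_shift`).

Membership in the class is controlled by the bipartite incidence graph: a connected hypergraph with
a cycle is unicyclic as soon as its incidences number `|V| + |E|`. For uniform hypergraphs this
count depends only on the number of edges, so a move preserves unicyclicity if connectivity, the
cycle and distinctness of edges survive (`shift_mem_unicyclicClass`). -/

open scoped Matrix

/-! ### Moments of symmetric matrices and sums of exponentials -/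

theorem Matrix.abs_pow_apply_le {V : Type*} [Fintype V] [DecidableEq V] {M M' : Matrix V V ℝ}
    (h : ∀ x y, |M x y| ≤ M' x y) (j : ℕ) (x y : V) : |(M ^ j) x y| ≤ (M' ^ j) x y := by
  induction j generalizing x y with
  | zero =>
    by_cases hxy : x = y <;> simp [hxy]
  | succ j ih =>
    rw [pow_succ, pow_succ, Matrix.mul_apply, Matrix.mul_apply]
    refine (Finset.abs_sum_le_sum_abs _ _).trans (Finset.sum_le_sum fun z _ => ?_)
    rw [abs_mul]
    exact mul_le_mul (ih x z) (h z y) (abs_nonneg _) ((abs_nonneg _).trans (ih x z))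

theorem Matrix.trace_pow_le_of_abs_le {V : Type*} [Fintype V] [DecidableEq V]
    {M M' : Matrix V V ℝ} (h : ∀ x y, |M x y| ≤ M' x y) (j : ℕ) :
    (M ^ j).trace ≤ (M' ^ j).trace :=
  Finset.sum_le_sum fun x _ => (le_abs_self _).trans (Matrix.abs_pow_apply_le h j x x)

/-- For a symmetric matrix the trace of the square is the sum of the squares of all entries. -/
theorem Matrix.trace_sq_lt_of_abs_lt {V : Type*} [Fintype V] {M M' : Matrix V V ℝ}
    (hM : M.IsSymm) (hM' : M'.IsSymm) (h : ∀ x y, |M x y| ≤ M' x y)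
    (hlt : ∃ x y, |M x y| < M' x y) : (M * M).trace < (M' * M').trace := by
  obtain ⟨x, y, hxy⟩ := hlt
  have key : ∀ a b, M a b * M b a ≤ M' a b * M' b a := by
    intro a b
    rw [hM.apply, hM'.apply]
    exact abs_le_iff_mul_self_le.mp ((h b a).trans (le_abs_self _)) 
  simp only [Matrix.trace, Matrix.diag, Matrix.mul_apply]
  refine Finset.sum_lt_sum (fun a _ => Finset.sum_le_sum fun b _ => key a b)
    ⟨x, Finset.mem_univ _, Finset.sum_lt_sum (fun b _ => key x b) ⟨y, Finset.mem_univ _, ?_⟩⟩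
  rw [← hM.apply x y, ← hM'.apply x y] at hxy; rw [← hM.apply x y, ← hM'.apply x y]
  exact abs_lt_iff_mul_self_lt.mp (hxy.trans_le (le_abs_self _))

/-- If `M'` dominates `|M|` and the walks `o → v → y` and `o → w → y` cannot both carry the full
weight of `M'` with equal sign, then the fourth moments differ or the second ones do. -/
theorem Matrix.exists_trace_pow_lt {V : Type*} [Fintype V] [DecidableEq V] {M M' : Matrix V V ℝ}
    (hM : M.IsSymm) (hM' : M'.IsSymm) (h : ∀ x y, |M x y| ≤ M' x y) {o v w y : V} (hvw : v ≠ w)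
    (how : M o w < M' o w) (hwy : -M' w y < M w y) (hov : 0 < M o v) (hvy : 0 < M v y) :
    ∃ j, (M ^ j).trace < (M' ^ j).trace := by
  -- A strict entry already separates the second moments. Otherwise `|M| = M'` everywhere, so `M o
  -- w` is negative while `M w y`, `M o v`, `M v y` are positive: the two-step walks through `v` and
  -- `w` partly cancel in `M ^ 2` but not in `M' ^ 2`, and the second-moment argument applies to the
  -- squares.
  by_cases hlt : ∃ x y, |M x y| < M' x y
  · exact ⟨2, by simpa only [pow_two] using Matrix.trace_sq_lt_of_abs_lt hM hM' h hlt⟩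
  · push Not at hlt
    have heq : ∀ x y, |M x y| = M' x y := fun x y => (h x y).antisymm (hlt x y)
    have h1 : M o w = -M' o w := by
      rcases abs_choice (M o w) with h' | h' <;> have := heq o w <;> linarith
    have h2 : M w y = M' w y := by
      rcases abs_choice (M w y) with h' | h' <;> have := heq w y <;> linarith
    have h3 : M' o v = M o v := by rw [← heq, abs_of_pos hov]
    have h4 : M' v y = M v y := by rw [← heq, abs_of_pos hvy]
    refine ⟨4, ?_⟩
    have e4 : ∀ N : Matrix V V ℝ, N ^ 4 = (N ^ 2) * (N ^ 2) := fun N => by rw [← pow_add]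
    rw [e4, e4]
    refine Matrix.trace_sq_lt_of_abs_lt (hM.pow 2) (hM'.pow 2)
      (Matrix.abs_pow_apply_le h 2) ⟨o, y, ?_⟩
    rw [pow_two, pow_two, Matrix.mul_apply, Matrix.mul_apply,
      ← Finset.add_sum_erase _ _ (Finset.mem_univ v), ← Finset.add_sum_erase _ _ (Finset.mem_univ v),
      ← Finset.add_sum_erase _ _ (Finset.mem_erase.mpr ⟨hvw.symm, Finset.mem_univ w⟩),
      ← Finset.add_sum_erase _ _ (Finset.mem_erase.mpr ⟨hvw.symm, Finset.mem_univ w⟩)]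
    have hrest : |∑ z ∈ (Finset.univ.erase v).erase w, M o z * M z y| ≤
        ∑ z ∈ (Finset.univ.erase v).erase w, M' o z * M' z y := by
      refine (Finset.abs_sum_le_sum_abs _ _).trans (Finset.sum_le_sum fun z _ => ?_)
      rw [abs_mul, heq, heq]
    have p1 : 0 < M o v * M v y := mul_pos hov hvy
    have p2 : 0 < M' o w * M' w y := mul_pos (by linarith) (by linarith)
    rw [h1, h2, h3, h4, abs_lt]
    rw [abs_le] at hrest
    constructor <;> nlinarith [hrest.1, hrest.2]

theorem Matrix.IsHermitian.trace_add_smul_one_pow {V : Type*} [Fintype V] [DecidableEq V]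
    {A : Matrix V V ℝ} (hA : A.IsHermitian) (c : ℝ) (j : ℕ) :
    ((A + c • (1 : Matrix V V ℝ)) ^ j).trace = ∑ i, (hA.eigenvalues i + c) ^ j := by
  set U : Matrix V V ℝ := (hA.eigenvectorUnitary : Matrix V V ℝ) with hU
  have hUU : star U * U = 1 := Unitary.coe_star_mul_self hA.eigenvectorUnitary
  have hUU' : U * star U = 1 := Unitary.coe_mul_star_self hA.eigenvectorUnitary
  have hs : A = U * Matrix.diagonal hA.eigenvalues * star U := by
    conv_lhs => rw [hA.spectral_theorem, Unitary.conjStarAlgAut_apply]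
    rfl
  have hAc : A + c • (1 : Matrix V V ℝ) =
      U * Matrix.diagonal (fun i => hA.eigenvalues i + c) * star U := by
    have : Matrix.diagonal (fun i => hA.eigenvalues i + c) =
        Matrix.diagonal hA.eigenvalues + c • (1 : Matrix V V ℝ) := by
      rw [← Matrix.diagonal_one, ← Matrix.diagonal_smul, Matrix.diagonal_add]
      simp [Pi.smul_apply]
    rw [this, mul_add, add_mul, ← hs]
    simp [hUU']
  have hpow : (A + c • (1 : Matrix V V ℝ)) ^ j =
      U * Matrix.diagonal (fun i => hA.eigenvalues i + c) ^ j * star U := by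
    rw [hAc]
    induction j with
    | zero => simp [hUU']
    | succ j ih =>
      rw [pow_succ, ih, pow_succ]
      simp only [mul_assoc]
      rw [← mul_assoc (star U) U, hUU, one_mul]
  rw [hpow, Matrix.trace_mul_comm, ← mul_assoc, hUU, one_mul, Matrix.diagonal_pow,
    Matrix.trace_diagonal]
  rfl

theorem Matrix.trace_conj_pow {V : Type*} [Fintype V] [DecidableEq V] {Q : Matrix V V ℝ}
    (hQ : Qᵀ * Q = 1) (B : Matrix V V ℝ) (j : ℕ) : ((Q * B * Qᵀ) ^ j).trace = (B ^ j).trace := by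
  have hpow : (Q * B * Qᵀ) ^ j * Q = Q * B ^ j := by
    induction j with
    | zero => simp
    | succ j ih =>
      rw [pow_succ, mul_assoc, mul_assoc (Q * B), hQ, mul_one, ← mul_assoc, ih, mul_assoc, ← pow_succ]
  have hQ' : Q * Qᵀ = 1 := mul_eq_one_comm.mp hQ
  calc ((Q * B * Qᵀ) ^ j).trace = ((Q * B * Qᵀ) ^ j * Q * Qᵀ).trace := by
        rw [mul_assoc _ Q, hQ', mul_one]
    _ = (B ^ j).trace := by
        rw [hpow, Matrix.trace_mul_comm, ← mul_assoc, hQ, one_mul]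

/-- Expand `exp (a i + c)` in its power series; the common factor `exp c` cancels at the end, so the
shift `c` is free. -/
theorem sum_exp_lt_sum_exp_of_moments {ι : Type*} [Fintype ι] {a b : ι → ℝ} (c : ℝ)
    (hle : ∀ j : ℕ, ∑ i, (a i + c) ^ j ≤ ∑ i, (b i + c) ^ j)
    (hlt : ∃ j : ℕ, ∑ i, (a i + c) ^ j < ∑ i, (b i + c) ^ j) :
    ∑ i, Real.exp (a i) < ∑ i, Real.exp (b i) := by
  have key : ∀ d : ι → ℝ, HasSum (fun j : ℕ => (∑ i, (d i + c) ^ j) / (j.factorial : ℝ))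
      (∑ i, Real.exp (d i + c)) := by
    intro d
    have : ∀ i ∈ Finset.univ, HasSum (fun j : ℕ => (d i + c) ^ j / (j.factorial : ℝ))
        (Real.exp (d i + c)) := fun i _ => by
      rw [Real.exp_eq_exp_ℝ]
      exact NormedSpace.expSeries_div_hasSum_exp (d i + c)
    simpa only [Finset.sum_div] using hasSum_sum this
  obtain ⟨j, hj⟩ := hlt
  have h := hasSum_lt (fun j => div_le_div_of_nonneg_right (hle j) (Nat.cast_nonneg _))
    (div_lt_div_of_pos_right hj (Nat.cast_pos.mpr j.factorial_pos)) (key a) (key b)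
  simp only [Real.exp_add, ← Finset.sum_mul] at h
  exact lt_of_mul_lt_mul_right h (Real.exp_pos c).le

/-- Comparison of Estrada indices by an orthogonal change of basis: after a shift by a multiple of
the identity, one matrix dominates the absolute value of the other. -/
theorem Matrix.IsHermitian.sum_exp_eigenvalues_lt {V : Type*} [Fintype V] [DecidableEq V]
    {A A' Q : Matrix V V ℝ} (hA : A.IsHermitian) (hA' : A'.IsHermitian) (hQ : Qᵀ * Q = 1) (c : ℝ)
    (h : ∀ x y, |(Q * (A + c • (1 : Matrix V V ℝ)) * Qᵀ) x y| ≤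
      (Q * (A' + c • (1 : Matrix V V ℝ)) * Qᵀ) x y)
    {o v w y : V} (hvw : v ≠ w)
    (how : (Q * (A + c • (1 : Matrix V V ℝ)) * Qᵀ) o w <
      (Q * (A' + c • (1 : Matrix V V ℝ)) * Qᵀ) o w)
    (hwy : -(Q * (A' + c • (1 : Matrix V V ℝ)) * Qᵀ) w y <
      (Q * (A + c • (1 : Matrix V V ℝ)) * Qᵀ) w y)
    (hov : 0 < (Q * (A + c • (1 : Matrix V V ℝ)) * Qᵀ) o v)
    (hvy : 0 < (Q * (A + c • (1 : Matrix V V ℝ)) * Qᵀ) v y) :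
    ∑ i, Real.exp (hA.eigenvalues i) < ∑ i, Real.exp (hA'.eigenvalues i) := by
  have symm : ∀ {B : Matrix V V ℝ}, B.IsHermitian →
      (Q * (B + c • (1 : Matrix V V ℝ)) * Qᵀ).IsSymm := by
    intro B hB
    have : Bᵀ = B := by simpa [Matrix.IsHermitian, Matrix.conjTranspose_eq_transpose_of_trivial] using hB
    simp [Matrix.IsSymm, Matrix.transpose_mul, this, mul_assoc]
  have tr : ∀ {B : Matrix V V ℝ} (hB : B.IsHermitian) (j : ℕ),
      ((Q * (B + c • (1 : Matrix V V ℝ)) * Qᵀ) ^ j).trace = ∑ i, (hB.eigenvalues i + c) ^ j :=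
    fun hB j => by rw [Matrix.trace_conj_pow hQ, hB.trace_add_smul_one_pow]
  apply sum_exp_lt_sum_exp_of_moments c
  · intro j
    rw [← tr hA, ← tr hA']
    exact Matrix.trace_pow_le_of_abs_le h j
  · obtain ⟨j, hj⟩ := Matrix.exists_trace_pow_lt (symm hA) (symm hA') h hvw how hwy hov hvy
    exact ⟨j, by rwa [← tr hA, ← tr hA']⟩

/-! ### Folding along an involution -/

/-- `σ` is an involution whose moved points split into `R` and its mirror image. -/
structure IsFolding {V : Type*} (σ : V → V) (R : Set V) : Prop where
  involutive : Function.Involutive σ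
  notMem_of_mem : ∀ x ∈ R, σ x ∉ R
  fixed : ∀ x, x ∉ R → σ x ∉ R → σ x = x

open Classical in
/-- Symmetrise a function along an involution `σ`: the antisymmetric part is put on `R`, the
symmetric part on the mirror image of `R`. -/
noncomputable def foldSum {V : Type*} (σ : V → V) (R : Set V) (g : V → ℝ) (x : V) : ℝ :=
  if x ∈ R then g (σ x) - g x else if σ x = x then g x else g x + g (σ x)

open Classical in
/-- The normalising factor making `foldSum` an isometry. -/
noncomputable def foldScale {V : Type*} (σ : V → V) (x : V) : ℝ :=
  if σ x = x then 1 else (√2)⁻¹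

open Classical in
/-- The orthogonal matrix of the symmetrisation `foldSum`. -/
noncomputable def foldMatrix {V : Type*} (σ : V → V) (R : Set V) : Matrix V V ℝ :=
  Matrix.of fun x z => foldScale σ x *
    ((if z = x then (if x ∈ R then -1 else 1) else 0) + if z = σ x ∧ σ x ≠ x then 1 else 0)

section Folding

variable {V : Type*} {σ : V → V} {R : Set V}

theorem IsFolding.ne_of_mem (hσ : IsFolding σ R) {x : V} (hx : x ∈ R) : σ x ≠ x :=
  fun h => hσ.notMem_of_mem x hx (h.symm ▸ hx)

theorem foldScale_pos (σ : V → V) (x : V) : 0 < foldScale σ x := by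
  unfold foldScale
  split_ifs <;> positivity

theorem foldSum_congr {g g' : V → ℝ} {x : V} (h : g x = g' x) (h' : g (σ x) = g' (σ x)) :
    foldSum σ R g x = foldSum σ R g' x := by
  simp only [foldSum, h, h']

theorem foldSum_sum {ι : Type*} (s : Finset ι) (c : ι → ℝ) (g : ι → V → ℝ) (x : V) :
    foldSum σ R (fun a => ∑ i ∈ s, c i * g i a) x = ∑ i ∈ s, c i * foldSum σ R (g i) x := by
  unfold foldSum
  split_ifs
  · rw [← Finset.sum_sub_distrib]
    exact Finset.sum_congr rfl fun i _ => by ring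
  · rfl
  · rw [← Finset.sum_add_distrib]
    exact Finset.sum_congr rfl fun i _ => by ring

theorem foldMatrix_transpose (hσ : IsFolding σ R) : (foldMatrix σ R)ᵀ = foldMatrix σ R := by
  ext x y
  rw [Matrix.transpose_apply]
  by_cases hxy : x = y
  · rw [hxy]
  · have hyx : ¬ y = x := fun h => hxy h.symm
    have e1 : x = σ y ↔ y = σ x := ⟨fun h => by rw [h, hσ.involutive], fun h => by
      rw [h, hσ.involutive]⟩
    simp only [foldMatrix, Matrix.of_apply, foldScale, hxy, hyx, if_false, e1]
    by_cases h : y = σ x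
    · have h2 : σ y = x := (e1.mpr h).symm
      have h3 : σ x ≠ x := fun h' => hyx (h.trans h')
      have h4 : σ y ≠ y := fun h' => hxy (h2.symm.trans h')
      simp [h3, h]
      simp [h2, hxy]
    · simp [h, e1]

variable [Fintype V]

theorem sum_foldMatrix_mul (hσ : IsFolding σ R) (g : V → ℝ) (x : V) :
    ∑ z, foldMatrix σ R x z * g z = foldScale σ x * foldSum σ R g x := by
  classical
  have h1 : ∀ z, foldMatrix σ R x z * g z = foldScale σ x *
      ((if z = x then (if x ∈ R then -1 else 1) * g z else 0) +
        if z = σ x then (if σ x ≠ x then 1 else 0) * g z else 0) := by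
    intro z
    simp only [foldMatrix, Matrix.of_apply]
    split_ifs <;> first | ring1 | (exfalso; tauto)
  simp only [h1, ← Finset.mul_sum, Finset.sum_add_distrib, Finset.sum_ite_eq', Finset.mem_univ,
    if_true]
  congr 1
  unfold foldSum
  by_cases hx : x ∈ R
  · simp [hx, hσ.ne_of_mem hx]
    ring
  · by_cases hx' : σ x = x <;> simp [hx, hx']

/-- On a pair `(x, σ x)` with `x ∈ R` the matrix is the reflection `(√2)⁻¹ • !![-1, 1; 1, 1]`, and
it is `1` on fixed points. Being symmetric as well, it is orthogonal. -/
theorem foldMatrix_mul_self [DecidableEq V] (hσ : IsFolding σ R) :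
    foldMatrix σ R * foldMatrix σ R = 1 := by
  ext x y
  rw [Matrix.mul_apply, sum_foldMatrix_mul hσ]
  have hss : (√2)⁻¹ * (√2)⁻¹ = (2 : ℝ)⁻¹ := by
    rw [← mul_inv, Real.mul_self_sqrt (by norm_num)]
  have hsc : foldScale σ (σ x) = foldScale σ x := by
    simp only [foldScale, hσ.involutive x, eq_comm]
  have e1 : σ x = σ y ↔ x = y := hσ.involutive.injective.eq_iff
  have e2 : y = σ x ↔ σ y = x := ⟨fun h => by rw [h, hσ.involutive], fun h => by
      rw [← h, hσ.involutive]⟩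
  simp only [foldSum, foldMatrix, Matrix.of_apply, hsc, hσ.involutive x]
  rw [Matrix.one_apply]
  by_cases hx : x ∈ R
  · have h1 := hσ.notMem_of_mem x hx
    have h2 := hσ.ne_of_mem hx
    have h3 : foldScale σ x = (√2)⁻¹ := by simp [foldScale, h2]
    rw [h3]
    by_cases hxy : y = x
    · subst hxy
      simp [hx, h2, h2.symm]
      linear_combination 2 * hss
    · by_cases hy : y = σ x
      · subst hy
        simp [hx, h1, h2, h2.symm]
      · simp [hx, h2, h2.symm, hxy, hy, Ne.symm hxy]
  · by_cases h2 : σ x = x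
    · have h3 : foldScale σ x = 1 := by simp [foldScale, h2]
      simp [hx, h2, h3, eq_comm]
    · have h1 : σ x ∈ R := by
        by_contra h
        exact h2 (hσ.fixed x hx h)
      have h3 : foldScale σ x = (√2)⁻¹ := by simp [foldScale, h2]
      rw [h3]
      have h4 : ¬ x = σ x := fun h => h2 h.symm
      by_cases hxy : y = x
      · subst hxy
        simp [hx, h2, h4]
        linear_combination 2 * hss
      · by_cases hy : y = σ x
        · subst hy
          simp [hx, h1, h2, h4]
        · simp [hx, h2, h4, hxy, hy, Ne.symm hxy]

theorem foldMatrix_conj_apply (hσ : IsFolding σ R) (B : Matrix V V ℝ) (x y : V) :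
    (foldMatrix σ R * B * (foldMatrix σ R)ᵀ) x y =
      foldScale σ x * foldScale σ y * foldSum σ R (fun a => foldSum σ R (B a) y) x := by
  have h1 : ∀ a, (B * (foldMatrix σ R)ᵀ) a y = foldScale σ y * foldSum σ R (B a) y := by
    intro a
    rw [← sum_foldMatrix_mul hσ, Matrix.mul_apply]
    exact Finset.sum_congr rfl fun z _ => by rw [Matrix.transpose_apply, mul_comm]
  rw [mul_assoc, Matrix.mul_apply]
  simp only [h1]
  rw [sum_foldMatrix_mul hσ]
  unfold foldSum
  split_ifs <;> ring

end Folding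

/-! ### Folded adjacency matrices -/

namespace Hypergraph

variable {V : Type*}

@[simp] theorem adjMatrix_apply_self (H : Hypergraph V) (x : V) : H.adjMatrix x x = 0 := by
  simp [adjMatrix]

theorem adjMatrix_nonneg (H : Hypergraph V) (x y : V) : 0 ≤ H.adjMatrix x y := by
  simp only [adjMatrix, Matrix.of_apply]
  split_ifs <;> positivity

variable [Fintype V]

/-- The finite set of edges. -/
noncomputable def edges (H : Hypergraph V) : Finset (Set V) := (Set.toFinite E(H)).toFinset

@[simp] theorem mem_edges {H : Hypergraph V} {f : Set V} : f ∈ H.edges ↔ f ∈ E(H) := by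
  simp [edges]

/-- The symmetrised indicator function of an edge. -/
noncomputable def foldInd (σ : V → V) (R : Set V) (f : Set V) : V → ℝ :=
  foldSum σ R (f.indicator 1)

/-- The off-diagonal entries of the folded adjacency matrix, up to normalisation. -/
noncomputable def foldEntry (H : Hypergraph V) (σ : V → V) (R : Set V) (x y : V) : ℝ :=
  ∑ f ∈ H.edges, foldInd σ R f x * foldInd σ R f y

theorem adjMatrix_apply_of_ne (H : Hypergraph V) {x y : V} (h : x ≠ y) :
    H.adjMatrix x y = ∑ f ∈ H.edges, f.indicator 1 x * f.indicator 1 y := by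
  classical
  have : {f ∈ E(H) | x ∈ f ∧ y ∈ f} = ((H.edges.filter fun f => x ∈ f ∧ y ∈ f : Finset (Set V)) :
      Set (Set V)) := by
    ext f
    simp
  simp only [adjMatrix, Matrix.of_apply, h, if_false, this, Set.ncard_coe_finset,
    Finset.card_filter, Nat.cast_sum]
  refine Finset.sum_congr rfl fun f _ => ?_
  by_cases hx : x ∈ f <;> by_cases hy : y ∈ f <;> simp [hx, hy]

/-- Away from the diagonal the adjacency matrix is a sum of rank-one matrices, one per edge, and
folding both sides of a rank-one matrix folds its two factors. The conditions on `y` keep all four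
pairs from `{x, σ x} × {y, σ y}` off the diagonal. -/
theorem foldSum_foldSum_adjMatrix (H : Hypergraph V) {σ : V → V} {R : Set V}
    (hσ : IsFolding σ R) {x y : V} (h1 : y ≠ x) (h2 : y ≠ σ x) :
    foldSum σ R (fun a => foldSum σ R (H.adjMatrix a) y) x = H.foldEntry σ R x y := by
  have h3 : σ y ≠ x := fun h => h2 (by rw [← h, hσ.involutive])
  have h4 : σ y ≠ σ x := fun h => h1 (hσ.involutive.injective h)
  have key : ∀ a, (a = x ∨ a = σ x) → foldSum σ R (H.adjMatrix a) y =
      ∑ f ∈ H.edges, foldInd σ R f y * f.indicator 1 a := by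
    intro a ha
    have hb : ∀ b, (b = y ∨ b = σ y) → H.adjMatrix a b =
        ∑ f ∈ H.edges, f.indicator 1 a * f.indicator 1 b := by
      intro b hb
      apply adjMatrix_apply_of_ne
      rcases ha with rfl | rfl <;> rcases hb with rfl | rfl
      exacts [h1.symm, h3.symm, h2.symm, h4.symm]
    rw [foldSum_congr (g' := fun b => ∑ f ∈ H.edges, f.indicator 1 a * f.indicator 1 b)
      (hb _ (Or.inl rfl)) (hb _ (Or.inr rfl)), foldSum_sum]
    exact Finset.sum_congr rfl fun f _ => mul_comm _ _
  rw [foldSum_congr (g' := fun a => ∑ f ∈ H.edges, foldInd σ R f y * f.indicator 1 a)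
    (key x (Or.inl rfl)) (key (σ x) (Or.inr rfl)), foldSum_sum]
  exact Finset.sum_congr rfl fun f _ => mul_comm _ _

theorem foldSum_foldSum_add_smul_one [DecidableEq V] (H : Hypergraph V) {σ : V → V} {R : Set V}
    (hσ : IsFolding σ R) {x y : V} (h1 : y ≠ x) (h2 : y ≠ σ x) (c : ℝ) :
    foldSum σ R (fun a => foldSum σ R ((H.adjMatrix + c • (1 : Matrix V V ℝ)) a) y) x =
      H.foldEntry σ R x y := by
  have h3 : σ y ≠ x := fun h => h2 (by rw [← h, hσ.involutive])
  have h4 : σ y ≠ σ x := fun h => h1 (hσ.involutive.injective h)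
  rw [← foldSum_foldSum_adjMatrix H hσ h1 h2]
  refine foldSum_congr ?_ ?_ <;> refine foldSum_congr ?_ ?_ <;>
    simp [h1.symm, h2.symm, h3.symm, h4.symm]

theorem adjMatrix_le_card (H : Hypergraph V) (x y : V) : H.adjMatrix x y ≤ H.edges.card := by
  by_cases h : x = y
  · simp [h]
  · rw [adjMatrix_apply_of_ne H h, Finset.card_eq_sum_ones, Nat.cast_sum]
    refine Finset.sum_le_sum fun f _ => ?_
    by_cases hx : x ∈ f <;> by_cases hy : y ∈ f <;> simp [hx, hy]

/-- Folding criterion for the comparison of Estrada indices. -/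
theorem estradaIndex_lt_of_foldEntry {H H' : Hypergraph V} {σ : V → V} {R : Set V}
    (hσ : IsFolding σ R) (hadj : ∀ x, H.adjMatrix x (σ x) = H'.adjMatrix x (σ x))
    (hle : ∀ x y, y ≠ x → y ≠ σ x → |H.foldEntry σ R x y| ≤ H'.foldEntry σ R x y)
    {o v w y : V} (hvw : v ≠ w) (wo : w ≠ o) (wo' : w ≠ σ o) (yw : y ≠ w) (yw' : y ≠ σ w)
    (vo : v ≠ o) (vo' : v ≠ σ o) (yv : y ≠ v) (yv' : y ≠ σ v)
    (how : H.foldEntry σ R o w < H'.foldEntry σ R o w)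
    (hwy : -H'.foldEntry σ R w y < H.foldEntry σ R w y)
    (hov : 0 < H.foldEntry σ R o v) (hvy : 0 < H.foldEntry σ R v y) :
    H.estradaIndex < H'.estradaIndex := by
  classical
  -- This shift makes the folded diagonal nonnegative: for `x ∈ R` the entry is proportional to `c -
  -- A x (σ x)`, and no adjacency entry exceeds the number of edges.
  set c : ℝ := (H.edges.card : ℝ) with hc
  have hQ : (foldMatrix σ R)ᵀ * foldMatrix σ R = 1 := by
    rw [foldMatrix_transpose hσ, foldMatrix_mul_self hσ]
  have entry : ∀ (K : Hypergraph V) (x y : V), y ≠ x → y ≠ σ x →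
      (foldMatrix σ R * (K.adjMatrix + c • (1 : Matrix V V ℝ)) * (foldMatrix σ R)ᵀ) x y =
        foldScale σ x * foldScale σ y * K.foldEntry σ R x y := fun K x y h1 h2 => by
    rw [foldMatrix_conj_apply hσ, foldSum_foldSum_add_smul_one K hσ h1 h2]
  have sp := foldScale_pos σ
  have main := Matrix.IsHermitian.sum_exp_eigenvalues_lt (A := H.adjMatrix) (A' := H'.adjMatrix)
    (Q := foldMatrix σ R) H.adjMatrix_isHermitian H'.adjMatrix_isHermitian hQ c ?_ hvw
    (o := o) (y := y) ?_ ?_ ?_ ?_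
  · unfold estradaIndex
    convert main
  · intro x y
    by_cases h : y ≠ x ∧ y ≠ σ x
    · rw [entry _ _ _ h.1 h.2, entry _ _ _ h.1 h.2, abs_mul,
        abs_of_pos (mul_pos (sp x) (sp y))]
      exact mul_le_mul_of_nonneg_left (hle x y h.1 h.2) (mul_pos (sp x) (sp y)).le
    · have hxσ : H.adjMatrix (σ x) x = H'.adjMatrix (σ x) x := by
        have := hadj (σ x)
        rwa [hσ.involutive x] at this
      have hsymm : ∀ a b, H.adjMatrix a b = H.adjMatrix b a := fun a b => by
        simpa using H.adjMatrix_isHermitian.apply b a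
      rw [foldMatrix_conj_apply hσ, foldMatrix_conj_apply hσ]
      -- When `y` is `x` or `σ x`, only diagonal entries and the entries between `x` and `σ x`
      -- enter, and these agree for `H` and `H'` by `hadj`.
      have heq : foldSum σ R
            (fun a => foldSum σ R ((H'.adjMatrix + c • (1 : Matrix V V ℝ)) a) y) x =
          foldSum σ R (fun a => foldSum σ R ((H.adjMatrix + c • (1 : Matrix V V ℝ)) a) y) x := by
        have hy : y = x ∨ y = σ x := by tauto
        rcases hy with rfl | rfl
        · refine foldSum_congr ?_ ?_ <;> refine foldSum_congr ?_ ?_ <;> simp [hadj, hxσ]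
        · refine foldSum_congr ?_ ?_ <;> refine foldSum_congr ?_ ?_ <;>
            simp [hadj, hxσ, hσ.involutive x]
      rw [heq, abs_of_nonneg]
      refine mul_nonneg (mul_pos (sp x) (sp y)).le ?_
      have hb := H.adjMatrix_le_card x (σ x)
      have hb' := H.adjMatrix_nonneg x (σ x)
      have hc0 : 0 ≤ c := Nat.cast_nonneg _
      rw [← hc] at hb
      have hy : y = x ∨ y = σ x := by tauto
      by_cases hx : x ∈ R
      · have h1 := hσ.notMem_of_mem x hx
        have h2 := hσ.ne_of_mem hx
        rcases hy with rfl | rfl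
        · simp [foldSum, hx, h2, h2.symm, hsymm (σ y) y]
          linarith
        · simp [foldSum, hx, h1, h2, h2.symm, hσ.involutive x, hsymm (σ x) x,
            add_comm]
      · by_cases h2 : σ x = x
        · have hyx : y = x := by rcases hy with h | h <;> simp [h, h2]
          simp [foldSum, hx, h2, hyx, hc0]
        · have h1 : σ x ∈ R := by
            by_contra h
            exact h2 (hσ.fixed x hx h)
          have h4 : ¬ x = σ x := fun h => h2 h.symm
          rcases hy with rfl | rfl
          · simp [foldSum, hx, h2, h4, hsymm (σ y) y]
            linarith
          · simp [foldSum, hx, h1, h2, h4, hσ.involutive x, hsymm (σ x) x]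
  · rw [entry _ _ _ wo wo', entry _ _ _ wo wo']
    exact mul_lt_mul_of_pos_left how (mul_pos (sp _) (sp _))
  · rw [entry _ _ _ yw yw', entry _ _ _ yw yw', ← mul_neg]
    exact mul_lt_mul_of_pos_left hwy (mul_pos (sp _) (sp _))
  · rw [entry _ _ _ vo vo']
    exact mul_pos (mul_pos (sp _) (sp _)) hov
  · rw [entry _ _ _ yv yv']
    exact mul_pos (mul_pos (sp _) (sp _)) hvy

end Hypergraph

/-! ### Moving edges from a vertex to its mirror image -/

namespace Hypergraph

open Classical in
/-- Replace `w` by `z` in the sets of the family `F`. -/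
noncomputable def moveEdge {V : Type*} (F : Set (Set V)) (w z : V) (f : Set V) : Set V :=
  if f ∈ F then insert z (f \ {w}) else f

/-- Move the edges of the family `F` from `w` to `z`. -/
noncomputable def shift {V : Type*} (H : Hypergraph V) (F : Set (Set V)) (w z : V) :
    Hypergraph V where
  vertexSet := Set.univ
  edgeSet := moveEdge F w z '' E(H)
  subset_vertexSet_of_mem_edgeSet' := fun _ _ => Set.subset_univ _

section Move

variable {V : Type*} {F : Set (Set V)} {w z : V} {f : Set V}

theorem moveEdge_of_notMem (h : f ∉ F) : moveEdge F w z f = f := by simp [moveEdge, h]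

theorem mem_moveEdge_of_mem (h : f ∈ F) {x : V} :
    x ∈ moveEdge F w z f ↔ x = z ∨ (x ∈ f ∧ x ≠ w) := by simp [moveEdge, h]

theorem mem_moveEdge_iff_of_ne {x : V} (hw : x ≠ w) (hz : x ≠ z) :
    x ∈ moveEdge F w z f ↔ x ∈ f := by
  by_cases h : f ∈ F
  · simp [mem_moveEdge_of_mem h, hw, hz]
  · rw [moveEdge_of_notMem h]

theorem mem_moveEdge_of_mem_of_ne {x : V} (hx : x ∈ f) (hw : x ≠ w) : x ∈ moveEdge F w z f := by
  by_cases h : f ∈ F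
  · simp [mem_moveEdge_of_mem h, hw, hx]
  · rwa [moveEdge_of_notMem h]

theorem moveEdge_mem_shift {H : Hypergraph V} (hf : f ∈ E(H)) :
    moveEdge F w z f ∈ E(H.shift F w z) := ⟨f, hf, rfl⟩

theorem edges_shift [Fintype V] [DecidableEq (Set V)] (H : Hypergraph V) (F : Set (Set V))
    (w z : V) : (H.shift F w z).edges = H.edges.image (moveEdge F w z) := by
  ext f
  simp [shift]

theorem sum_edges_shift [Fintype V] {H : Hypergraph V}
    (hinj : Set.InjOn (moveEdge F w z) E(H)) (g : Set V → ℝ) :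
    ∑ f ∈ (H.shift F w z).edges, g f = ∑ f ∈ H.edges, g (moveEdge F w z f) := by
  classical
  rw [edges_shift, Finset.sum_image]
  intro a ha b hb
  exact hinj (by simpa using ha) (by simpa using hb)

end Move

section FoldInd

variable {V : Type*} {σ : V → V} {R : Set V}

theorem foldInd_nonneg_of_notMem {x : V} (hx : x ∉ R) (f : Set V) : 0 ≤ foldInd σ R f x := by
  have : ∀ a, 0 ≤ f.indicator (1 : V → ℝ) a := fun a => Set.indicator_nonneg (by simp) a
  unfold foldInd foldSum
  rw [if_neg hx]
  split_ifs
  · exact this x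
  · exact add_nonneg (this _) (this _)

theorem foldInd_nonneg_of_notMem_edge {x : V} {f : Set V} (hx : x ∉ f) : 0 ≤ foldInd σ R f x := by
  have : ∀ a, 0 ≤ f.indicator (1 : V → ℝ) a := fun a => Set.indicator_nonneg (by simp) a
  have h0 : f.indicator (1 : V → ℝ) x = 0 := by simp [hx]
  unfold foldInd foldSum
  split_ifs
  · rw [h0, sub_zero]
    exact this _
  · exact this x
  · exact add_nonneg (this _) (this _)

/-- A negative value needs `x ∈ R` and an edge that contains `x` but not `σ x`. -/
theorem foldInd_nonneg_of_imp {x : V} {f : Set V} (hx : x ∈ f → σ x ∈ f) :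
    0 ≤ foldInd σ R f x := by
  by_cases h : x ∈ f
  · have := hx h
    unfold foldInd foldSum
    split_ifs <;> simp [h, this]
  · exact foldInd_nonneg_of_notMem_edge h

theorem foldInd_pos_of_notMem {x : V} (hx : x ∉ R) {f : Set V} (hf : x ∈ f) :
    0 < foldInd σ R f x := by
  have : 0 ≤ f.indicator (1 : V → ℝ) (σ x) := Set.indicator_nonneg (by simp) _
  have h1 : f.indicator (1 : V → ℝ) x = 1 := by simp [hf]
  unfold foldInd foldSum
  rw [if_neg hx]
  split_ifs <;> linarith

theorem foldInd_of_mem {x : V} (hx : x ∈ R) (f : Set V) :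
    foldInd σ R f x = f.indicator 1 (σ x) - f.indicator 1 x := by
  simp [foldInd, foldSum, hx]

theorem foldInd_image (hσ : IsFolding σ R) (f : Set V) (x : V) [Decidable (x ∈ R)] :
    foldInd σ R (σ '' f) x = (if x ∈ R then -1 else 1) * foldInd σ R f x := by
  have h1 : ∀ a, (σ '' f).indicator (1 : V → ℝ) a = f.indicator 1 (σ a) := by
    intro a
    have : a ∈ σ '' f ↔ σ a ∈ f := by
      rw [hσ.involutive.image_eq_preimage_symm]
      rfl
    by_cases h : σ a ∈ f <;> simp [Set.indicator, this, h]
  unfold foldInd foldSum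
  simp only [h1, hσ.involutive x]
  split_ifs with h h'
  · ring
  · rw [h']
    ring
  · ring

end FoldInd

variable {V : Type*} [Fintype V]

/-- Moving edges from `w` to its mirror image `v` increases the Estrada index, if the remaining
edges are symmetric (the family `S`) or favour the side of `v`. -/
theorem estradaIndex_lt_shift {H : Hypergraph V} {σ : V → V} {R : Set V} (hσ : IsFolding σ R)
    {w v : V} (hw : w ∈ R) (hv : σ w = v) {S : Set (Set V)}
    (hS : ∀ f ∈ E(H), f ∈ S → σ '' f ∈ E(H) ∧ σ '' f ∈ S ∧
      ((∀ x ∈ f, x ∉ R) ∨ ∀ x ∈ f, σ x ∉ R))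
    (hR : ∀ f ∈ E(H), f ∉ S → ∀ x ∈ f, x ∈ R → x = w)
    {F : Set (Set V)} (hF : F = {f ∈ E(H) | f ∉ S ∧ w ∈ f ∧ v ∉ f})
    (hinj : Set.InjOn (moveEdge F w v) E(H))
    {f₀ : Set V} {o : V} (hf₀ : f₀ ∈ F) (ho : o ∈ f₀) (how : o ≠ w)
    {y : V} (yw : y ≠ w) (yv : y ≠ v)
    (hvy : ∃ f ∈ E(H), (f ∈ S → y ∉ R) ∧ 0 < foldInd σ R f v * foldInd σ R f y)
    (hwy : ∃ f ∈ E(H), (f ∈ S → y ∈ R) ∧ 0 < foldInd σ R f w * foldInd σ R f y) :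
    H.estradaIndex < (H.shift F w v).estradaIndex := by
  classical
  have hvw : σ v = w := by rw [← hv, hσ.involutive]
  have hvR : v ∉ R := hv ▸ hσ.notMem_of_mem w hw
  have hne : v ≠ w := fun h => hvR (h ▸ hw)
  have hFmem : ∀ {f}, f ∈ F ↔ f ∈ E(H) ∧ f ∉ S ∧ w ∈ f ∧ v ∉ f := fun {f} => by rw [hF]; rfl
  -- outside `S` the shift replaces the symmetrised indicator by its absolute value
  have nonneg : ∀ f ∈ E(H), f ∉ S → ∀ x, x ≠ w → 0 ≤ foldInd σ R f x := by
    intro f hf hfS x hx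
    by_cases hxR : x ∈ R
    · exact foldInd_nonneg_of_notMem_edge fun hxf => hx (hR f hf hfS x hxf hxR)
    · exact foldInd_nonneg_of_notMem hxR f
  have move : ∀ f ∈ E(H), f ∉ S → ∀ x,
      foldInd σ R (moveEdge F w v f) x = |foldInd σ R f x| := by
    intro f hf hfS x
    by_cases hfF : f ∈ F
    · obtain ⟨-, -, hwf, hvf⟩ := hFmem.mp hfF
      have m1 : w ∉ moveEdge F w v f := by simp [mem_moveEdge_of_mem hfF, hne.symm]
      have m2 : v ∈ moveEdge F w v f := by simp [mem_moveEdge_of_mem hfF]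
      by_cases hxw : x = w
      · subst hxw
        simp [foldInd_of_mem hw, hv, m1, m2, hwf, hvf]
      · by_cases hxv : x = v
        · subst hxv
          simp [foldInd, foldSum, hvR, hvw, hne.symm, m1, m2, hwf, hvf]
        · rw [abs_of_nonneg (nonneg f hf hfS x hxw)]
          have s1 : σ x ≠ w := fun h => hxv (by rw [← hv, ← h, hσ.involutive])
          have s2 : σ x ≠ v := fun h => hxw (by rw [← hvw, ← h, hσ.involutive])
          refine foldSum_congr ?_ ?_ <;>
            simp [Set.indicator, mem_moveEdge_iff_of_ne, hxw, hxv, s1, s2]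
    · rw [moveEdge_of_notMem hfF, abs_of_nonneg]
      by_cases hxw : x = w
      · subst hxw
        refine foldInd_nonneg_of_imp fun h => ?_
        rw [hv]
        by_contra h'
        exact hfF (hFmem.mpr ⟨hf, hfS, h, h'⟩)
      · exact nonneg f hf hfS x hxw
  have moveS : ∀ f ∈ S, moveEdge F w v f = f := fun f hf =>
    moveEdge_of_notMem fun h => (hFmem.mp h).2.1 hf
  -- the symmetric part
  set T : V → V → ℝ := fun x y => ∑ f ∈ H.edges.filter (· ∈ S), foldInd σ R f x * foldInd σ R f y
    with hT
  -- The map `f ↦ σ '' f` permutes the edges in `S`, and by `foldInd_image` it negates each product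
  -- when exactly one of `x`, `y` lies in `R`; the sum equals its own negative.
  have T_zero : ∀ x y, ¬ (x ∈ R ↔ y ∈ R) → T x y = 0 := by
    intro x y hxy
    have : T x y = -T x y := by
      conv_lhs => rw [hT]
      simp only [hT]
      rw [← Finset.sum_neg_distrib]
      have hmem : ∀ f ∈ H.edges.filter (· ∈ S), σ '' f ∈ H.edges.filter (· ∈ S) := by
        intro f hf
        simp only [Finset.mem_filter, mem_edges] at hf ⊢
        exact ⟨(hS f hf.1 hf.2).1, (hS f hf.1 hf.2).2.1⟩
      have hinv : ∀ f : Set V, σ '' (σ '' f) = f := fun f => by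
        rw [← Set.image_comp, hσ.involutive.comp_self, Set.image_id]
      refine Finset.sum_nbij' (σ '' ·) (σ '' ·) hmem hmem (fun f _ => hinv f) (fun f _ => hinv f) ?_
      intro f _
      simp only [foldInd_image hσ]
      by_cases hx : x ∈ R <;> by_cases hy : y ∈ R <;> simp_all
    linarith
  -- Each edge in `S` avoids `R` or the mirror image of `R`, so its folded indicator has a constant
  -- sign on `R`.
  have term_nonneg : ∀ f ∈ H.edges.filter (· ∈ S), ∀ x y, (x ∈ R ↔ y ∈ R) →
      0 ≤ foldInd σ R f x * foldInd σ R f y := by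
    intro f hf x y hxy
    simp only [Finset.mem_filter, mem_edges] at hf
    by_cases hx : x ∈ R
    · have hy := hxy.mp hx
      rw [foldInd_of_mem hx, foldInd_of_mem hy]
      rcases (hS f hf.1 hf.2).2.2 with h | h
      · have hx' : x ∉ f := fun h' => h x h' hx
        have hy' : y ∉ f := fun h' => h y h' hy
        simp only [hx', hy', not_false_eq_true, Set.indicator_of_notMem, sub_zero]
        exact mul_nonneg (Set.indicator_nonneg (by simp) _) (Set.indicator_nonneg (by simp) _)
      · have hx' : σ x ∉ f := fun h' => h _ h' (by rwa [hσ.involutive])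
        have hy' : σ y ∉ f := fun h' => h _ h' (by rwa [hσ.involutive])
        simp only [hx', hy', not_false_eq_true, Set.indicator_of_notMem, zero_sub, neg_mul_neg]
        exact mul_nonneg (Set.indicator_nonneg (by simp) _) (Set.indicator_nonneg (by simp) _)
    · exact mul_nonneg (foldInd_nonneg_of_notMem hx f)
        (foldInd_nonneg_of_notMem (fun h => hx (hxy.mpr h)) f)
  have T_nonneg : ∀ x y, 0 ≤ T x y := by
    intro x y
    by_cases hxy : x ∈ R ↔ y ∈ R
    · exact Finset.sum_nonneg fun f hf => term_nonneg f hf x y hxy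
    · rw [T_zero x y hxy]
  have T_pos : ∀ x y, (x ∈ R ↔ y ∈ R) → (∃ f ∈ E(H), f ∈ S ∧
      0 < foldInd σ R f x * foldInd σ R f y) → 0 < T x y := by
    rintro x y hxy ⟨f, hf, hfS, hpos⟩
    exact Finset.sum_pos' (fun f hf => term_nonneg f hf x y hxy)
      ⟨f, by simp [hf, hfS], hpos⟩
  -- the remaining part
  set N : Finset (Set V) := H.edges.filter (· ∉ S) with hN
  have memN : ∀ {f}, f ∈ N ↔ f ∈ E(H) ∧ f ∉ S := fun {f} => by simp [hN]
  have entry : ∀ x y, H.foldEntry σ R x y =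
      T x y + ∑ f ∈ N, foldInd σ R f x * foldInd σ R f y := fun x y =>
    (Finset.sum_filter_add_sum_filter_not _ _ _).symm
  have entry' : ∀ x y, (H.shift F w v).foldEntry σ R x y =
      T x y + ∑ f ∈ N, |foldInd σ R f x| * |foldInd σ R f y| := by
    intro x y
    rw [foldEntry, sum_edges_shift hinj, ← Finset.sum_filter_add_sum_filter_not _ (· ∈ S)]
    congr 1
    · refine Finset.sum_congr rfl fun f hf => ?_
      rw [moveS f (Finset.mem_filter.mp hf).2]
    · refine Finset.sum_congr rfl fun f hf => ?_
      obtain ⟨h1, h2⟩ := memN.mp hf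
      rw [move f h1 h2, move f h1 h2]
  obtain ⟨hf₀E, hf₀S, hwf₀, hvf₀⟩ := hFmem.mp hf₀
  have hf₀N : f₀ ∈ N := memN.mpr ⟨hf₀E, hf₀S⟩
  have hoR : o ∉ R := fun h => how (hR f₀ hf₀E hf₀S o ho h)
  have hov : o ≠ v := fun h => hvf₀ (h ▸ ho)
  have hoσ : σ o ≠ w := fun h => hov (by rw [← hv, ← h, hσ.involutive])
  have hoσ' : σ o ≠ v := fun h => how (by rw [← hvw, ← h, hσ.involutive])
  have ho_pos : 0 < foldInd σ R f₀ o := foldInd_pos_of_notMem hoR ho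
  refine estradaIndex_lt_of_foldEntry hσ ?_ ?_ (o := o) (v := v) (w := w) (y := y) hne how.symm
    hoσ.symm yw (hv.symm ▸ yv) hov.symm hoσ'.symm yv (hvw.symm ▸ yw) ?_ ?_ ?_ ?_
  -- Entries between mirror images do not change: a moved edge contains `w` but not `v` before the
  -- move, and `v` but not `w` after it, so it never contributes to the pair `w`, `v`.
  · intro x
    by_cases hx : x = σ x
    · rw [← hx]
      simp
    · rw [adjMatrix_apply_of_ne _ hx, adjMatrix_apply_of_ne _ hx, sum_edges_shift hinj]
      refine Finset.sum_congr rfl fun f _ => ?_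
      by_cases hfF : f ∈ F
      · obtain ⟨-, -, hwf, hvf⟩ := hFmem.mp hfF
        have m1 : w ∉ moveEdge F w v f := by simp [mem_moveEdge_of_mem hfF, hne.symm]
        by_cases hxw : x = w
        · subst hxw
          simp [hv, hvf, m1]
        · by_cases hxv : x = v
          · subst hxv
            simp [hvw, hvf, m1]
          · have s1 : σ x ≠ w := fun h => hxv (by rw [← hv, ← h, hσ.involutive])
            have s2 : σ x ≠ v := fun h => hxw (by rw [← hvw, ← h, hσ.involutive])
            simp [Set.indicator, mem_moveEdge_iff_of_ne, hxw, hxv, s1, s2]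
      · rw [moveEdge_of_notMem hfF]
  · intro x y _ _
    rw [entry, entry']
    refine (abs_add_le _ _).trans ?_
    rw [abs_of_nonneg (T_nonneg x y)]
    gcongr
    refine (Finset.abs_sum_le_sum_abs _ _).trans (le_of_eq ?_)
    exact Finset.sum_congr rfl fun f _ => abs_mul _ _
  · rw [entry, entry']
    gcongr 1
    refine Finset.sum_lt_sum (fun f _ => ?_) ⟨f₀, hf₀N, ?_⟩
    · rw [← abs_mul]
      exact le_abs_self _
    · have : foldInd σ R f₀ w = -1 := by
        simp [foldInd_of_mem hw, hv, hwf₀, hvf₀]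
      rw [this, abs_of_pos ho_pos]
      norm_num
      linarith
  · have hsum : ∀ f ∈ N, 0 ≤ |foldInd σ R f w| * |foldInd σ R f y| +
        foldInd σ R f w * foldInd σ R f y := by
      intro f _
      rw [← abs_mul]
      linarith [neg_abs_le (foldInd σ R f w * foldInd σ R f y)]
    -- The right-hand side is the sum of the two folded entries at `(w, y)`, before and after the
    -- move. The witness of `hwy` makes it positive, through `T` if it lies in `S` and through the
    -- other edges if not.
    have key : 0 < T w y + T w y + ∑ f ∈ N, (|foldInd σ R f w| * |foldInd σ R f y| +
        foldInd σ R f w * foldInd σ R f y) := by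
      have hTn := T_nonneg w y
      obtain ⟨f, hf, h1, h2⟩ := hwy
      by_cases hfS : f ∈ S
      · have := T_pos w y (by simp [hw, h1 hfS]) ⟨f, hf, hfS, h2⟩
        have := Finset.sum_nonneg hsum
        linarith
      · have := Finset.sum_pos' hsum ⟨f, memN.mpr ⟨hf, hfS⟩, by positivity⟩
        linarith
    rw [Finset.sum_add_distrib] at key
    rw [entry, entry']
    linarith
  · rw [entry]
    refine add_pos_of_nonneg_of_pos (T_nonneg _ _) (Finset.sum_pos' (fun f _ =>
      mul_nonneg (foldInd_nonneg_of_notMem hoR f) (foldInd_nonneg_of_notMem hvR f))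
      ⟨f₀, hf₀N, mul_pos ho_pos ?_⟩)
    simp [foldInd, foldSum, hvR, hvw, hne.symm, hwf₀, hvf₀]
  · rw [entry]
    have hsum : ∀ f ∈ N, 0 ≤ foldInd σ R f v * foldInd σ R f y := fun f hf =>
      mul_nonneg (foldInd_nonneg_of_notMem hvR f)
        (nonneg f (memN.mp hf).1 (memN.mp hf).2 y yw)
    have hTn := T_nonneg v y
    obtain ⟨f, hf, h1, h2⟩ := hvy
    by_cases hfS : f ∈ S
    · have := T_pos v y (by simp [hvR, h1 hfS]) ⟨f, hf, hfS, h2⟩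
      have := Finset.sum_nonneg hsum
      linarith
    · have := Finset.sum_pos' hsum ⟨f, memN.mpr ⟨hf, hfS⟩, h2⟩
      linarith

end Hypergraph

/-! ### Two instances of the edge-moving criterion -/

/-- Two disjoint sets of equal size are interchanged by an involution that fixes all other points
and maps a given element of one set to a given element of the other. -/
theorem exists_involutive_interchange {V : Type*} [Finite V] {A B : Set V} (hAB : Disjoint A B)
    (hcard : A.ncard = B.ncard) {w v : V} (hw : w ∈ A) (hv : v ∈ B) :
    ∃ σ : V → V, Function.Involutive σ ∧ (∀ x ∈ A, σ x ∈ B) ∧ (∀ x ∈ B, σ x ∈ A) ∧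
      (∀ x, x ∉ A → x ∉ B → σ x = x) ∧ σ w = v := by
  classical
  have hcard' : Nat.card A = Nat.card B := hcard
  obtain ⟨β₀⟩ : Nonempty (A ≃ B) := Finite.card_eq.mp hcard'
  set β := β₀.setValue ⟨w, hw⟩ ⟨v, hv⟩ with hβ
  have hβw : β ⟨w, hw⟩ = ⟨v, hv⟩ := Equiv.setValue_eq _ _ _
  have hBA : ∀ x ∈ B, x ∉ A := fun x hx hx' => Set.disjoint_left.mp hAB hx' hx
  set σ : V → V := fun x => if hx : x ∈ A then (β ⟨x, hx⟩ : V)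
    else if hx : x ∈ B then (β.symm ⟨x, hx⟩ : V) else x with hσ
  have s1 : ∀ x (hx : x ∈ A), σ x = β ⟨x, hx⟩ := fun x hx => by simp [hσ, hx]
  have s2 : ∀ x (hx : x ∈ B), σ x = β.symm ⟨x, hx⟩ := fun x hx => by simp [hσ, hx, hBA x hx]
  have s3 : ∀ x, x ∉ A → x ∉ B → σ x = x := fun x h1 h2 => by simp [hσ, h1, h2]
  have m1 : ∀ x ∈ A, σ x ∈ B := fun x hx => by rw [s1 x hx]; exact Subtype.property _
  have m2 : ∀ x ∈ B, σ x ∈ A := fun x hx => by rw [s2 x hx]; exact Subtype.property _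
  refine ⟨σ, fun x => ?_, m1, m2, s3, by rw [s1 w hw, hβw]⟩
  by_cases hA : x ∈ A
  · rw [s2 _ (m1 x hA)]
    simp [s1 x hA]
  · by_cases hB : x ∈ B
    · rw [s1 _ (m2 x hB)]
      simp [s2 x hB]
    · rw [s3 x hA hB, s3 x hA hB]

namespace Hypergraph

variable {V : Type*} [Fintype V]

/-- Moving all edges at `w` that avoid `v` to `v` increases the Estrada index, unless all edges at
`w` contain `v` or vice versa. -/
theorem estradaIndex_lt_shift_of_ne {H : Hypergraph V} {w v : V} {F : Set (Set V)}
    (hF : F = {f ∈ E(H) | w ∈ f ∧ v ∉ f}) (hinj : Set.InjOn (moveEdge F w v) E(H))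
    {f₀ : Set V} {o : V} (hf₀ : f₀ ∈ F) (ho : o ∈ f₀) (how : o ≠ w)
    {h : Set V} {y : V} (hh : h ∈ E(H)) (hv : v ∈ h) (hw : w ∉ h) (hy : y ∈ h) (hyv : y ≠ v) :
    H.estradaIndex < (H.shift F w v).estradaIndex := by
  classical
  have hwv : w ≠ v := fun e => hw (e ▸ hv)
  have hσ : IsFolding (Equiv.swap w v) {w} := by
    refine ⟨Equiv.swap_apply_self w v, ?_, ?_⟩
    · rintro x rfl
      simpa using hwv.symm
    · intro x hx hx'
      refine Equiv.swap_apply_of_ne_of_ne hx fun e => hx' ?_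
      simp [e]
  have hyw : y ≠ w := fun e => hw (e ▸ hy)
  have p1 : 0 < foldInd (Equiv.swap w v) {w} h y := foldInd_pos_of_notMem (by simpa using hyw) hy
  have p2 : 0 < foldInd (Equiv.swap w v) {w} h v := foldInd_pos_of_notMem (by simpa using hwv.symm) hv
  have p3 : 0 < foldInd (Equiv.swap w v) {w} h w := by
    rw [foldInd_of_mem (Set.mem_singleton w)]
    simp [hv, hw]
  exact estradaIndex_lt_shift hσ rfl (Equiv.swap_apply_left w v) (S := ∅) (by simp)
    (fun f _ _ x _ hx => hx) (by simpa using hF) hinj hf₀ ho how hyw hyv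
    ⟨h, hh, by simp, mul_pos p2 p1⟩ ⟨h, hh, by simp, mul_pos p3 p1⟩

/-- Let `w ∈ g`, `v ∈ h` be private vertices of two edges of equal size, where the other vertices
of `g \ h` lie in no other edge. Moving all edges at `w` other than `g` that avoid `v` to `v`
increases the Estrada index, if `v` is better connected to the rest than `w`. -/
theorem estradaIndex_lt_shift_of_edges {H : Hypergraph V} {w v : V} {g h : Set V}
    (hg : g ∈ E(H)) (hh : h ∈ E(H)) (hcard : g.ncard = h.ncard) (hwg : w ∈ g) (hwh : w ∉ h)
    (hvh : v ∈ h) (hvg : v ∉ g) (hpriv : ∀ x ∈ g, x ∉ h → x ≠ w → ∀ f ∈ E(H), x ∈ f → f = g)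
    {F : Set (Set V)} (hF : F = {f ∈ E(H) | f ≠ g ∧ w ∈ f ∧ v ∉ f})
    (hinj : Set.InjOn (moveEdge F w v) E(H))
    {f₀ : Set V} {o : V} (hf₀ : f₀ ∈ F) (ho : o ∈ f₀) (how : o ≠ w)
    {f₁ : Set V} (hf₁ : f₁ ∈ E(H)) (hf₁g : f₁ ≠ g) (hf₁h : f₁ ≠ h) (hvf₁ : v ∈ f₁)
    (hstrict : (w ∉ f₁ ∧ ∃ y ∈ f₁, y ≠ v ∧ y ∉ g \ h) ∨
      (w ∈ f₁ ∧ ∃ c ∈ f₁, c ∈ h ∧ c ∉ g ∧ c ≠ v)) :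
    H.estradaIndex < (H.shift F w v).estradaIndex := by
  have hdisj : Disjoint (g \ h) (h \ g) :=
    Set.disjoint_left.mpr fun x hx hx' => hx.2 hx'.1
  have hcard' : (g \ h).ncard = (h \ g).ncard := by
    have h1 := Set.ncard_inter_add_ncard_sdiff_eq_ncard g h (Set.toFinite _)
    have h2 := Set.ncard_inter_add_ncard_sdiff_eq_ncard h g (Set.toFinite _)
    rw [Set.inter_comm] at h2
    omega
  obtain ⟨σ, hinv, m1, m2, s3, hwv⟩ :=
    exists_involutive_interchange hdisj hcard' (w := w) (v := v) ⟨hwg, hwh⟩ ⟨hvh, hvg⟩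
  have hσ : IsFolding σ (g \ h) := by
    refine ⟨hinv, fun x hx hx' => hx'.2 (m1 x hx).1, fun x hx hx' => s3 x hx fun hx'' => ?_⟩
    exact hx' (m2 x hx'')
  have hwR : w ∈ g \ h := ⟨hwg, hwh⟩
  have hvR : v ∉ g \ h := fun e => hvg e.1
  have hne : v ≠ w := fun e => hvg (e ▸ hwg)
  have img : ∀ {a b : Set V}, (∀ x ∈ a \ b, σ x ∈ b \ a) → (∀ x ∈ b \ a, σ x ∈ a \ b) →
      (∀ x, x ∈ a → x ∈ b → σ x = x) → σ '' a = b := by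
    intro a b h1 h2 h3
    ext x
    constructor
    · rintro ⟨z, hz, rfl⟩
      by_cases hzb : z ∈ b
      · rwa [h3 z hz hzb]
      · exact (h1 z ⟨hz, hzb⟩).1
    · intro hx
      by_cases hxa : x ∈ a
      · exact ⟨x, hxa, h3 x hxa hx⟩
      · exact ⟨σ x, (h2 x ⟨hx, hxa⟩).1, hinv x⟩
  have hgh : σ '' g = h := img m1 m2 fun x hx hx' => s3 x (fun e => e.2 hx') fun e => e.2 hx
  have hhg : σ '' h = g := img m2 m1 fun x hx hx' => s3 x (fun e => e.2 hx) fun e => e.2 hx'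
  -- The involution interchanges `g` and `h`, fixing their intersection, so `{g, h}` can serve as
  -- the symmetric family. This is why `g` can be left at `w`.
  have hS : ∀ f ∈ E(H), f ∈ ({g, h} : Set (Set V)) → σ '' f ∈ E(H) ∧
      σ '' f ∈ ({g, h} : Set (Set V)) ∧ ((∀ x ∈ f, x ∉ g \ h) ∨ ∀ x ∈ f, σ x ∉ g \ h) := by
    rintro f - (rfl | rfl)
    · rw [hgh]
      refine ⟨hh, by simp, Or.inr fun x hx hx' => ?_⟩
      have := m1 _ hx'
      rw [hinv] at this
      exact this.2 hx
    · rw [hhg]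
      exact ⟨hg, by simp, Or.inl fun x hx hx' => hx'.2 hx⟩
  have hf₁S : f₁ ∉ ({g, h} : Set (Set V)) := by simp [hf₁g, hf₁h]
  have hF' : F = {f ∈ E(H) | f ∉ ({g, h} : Set (Set V)) ∧ w ∈ f ∧ v ∉ f} := by
    rw [hF]
    ext f
    simp only [Set.mem_ofPred_eq, Set.mem_insert_iff, Set.mem_singleton_iff, not_or]
    refine and_congr_right fun _ => ⟨fun ⟨a, b, c⟩ => ⟨⟨a, ?_⟩, b, c⟩, fun ⟨a, b⟩ => ⟨a.1, b⟩⟩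
    rintro rfl
    exact hwh b
  have hR : ∀ f ∈ E(H), f ∉ ({g, h} : Set (Set V)) → ∀ x ∈ f, x ∈ g \ h → x = w := by
    intro f hf hfS x hx hxR
    by_contra hxw
    exact hfS (Or.inl (hpriv x hxR.1 hxR.2 hxw f hf hx))
  have qv : 0 < foldInd σ (g \ h) f₁ v := foldInd_pos_of_notMem hvR hvf₁
  -- If `w ∉ f₁`, then `f₁` is positive at `v`, `w` and `y`, and serves as both witnesses. If `w ∈
  -- f₁`, its folded indicator vanishes at `w`; with `y = σ c` in `R`, the edge `f₁` still links `v`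
  -- to `y`, and `g`, negative at both, links `w` to `y`.
  rcases hstrict with ⟨hwf₁, y, hy, hyv, hyR⟩ | ⟨hwf₁, c, hc, hch, hcg, hcv⟩
  · have qy : 0 < foldInd σ (g \ h) f₁ y := foldInd_pos_of_notMem hyR hy
    have qw : 0 < foldInd σ (g \ h) f₁ w := by
      rw [foldInd_of_mem hwR, hwv]
      simp [hvf₁, hwf₁]
    exact estradaIndex_lt_shift hσ hwR hwv hS hR hF' hinj hf₀ ho how (fun e => hwf₁ (e ▸ hy)) hyv
      ⟨f₁, hf₁, fun e => absurd e hf₁S, mul_pos qv qy⟩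
      ⟨f₁, hf₁, fun e => absurd e hf₁S, mul_pos qw qy⟩
  · have hyR : σ c ∈ g \ h := m2 c ⟨hch, hcg⟩
    have hyw : σ c ≠ w := fun e => hcv (by rw [← hwv, ← e, hinv])
    have hyf₁ : σ c ∉ f₁ := fun e => hf₁g (hpriv _ hyR.1 hyR.2 hyw f₁ hf₁ e)
    have qy : 0 < foldInd σ (g \ h) f₁ (σ c) := by
      rw [foldInd_of_mem hyR, hinv]
      simp [hc, hyf₁]
    have q1 : foldInd σ (g \ h) g w = -1 := by
      rw [foldInd_of_mem hwR, hwv]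
      simp [hwg, hvg]
    have q2 : foldInd σ (g \ h) g (σ c) = -1 := by
      rw [foldInd_of_mem hyR, hinv]
      simp [hcg, hyR.1]
    exact estradaIndex_lt_shift hσ hwR hwv hS hR hF' hinj hf₀ ho how hyw
      (fun e => hvR (e ▸ hyR))
      ⟨f₁, hf₁, fun e => absurd e hf₁S, mul_pos qv qy⟩
      ⟨g, hg, fun _ => hyR, by rw [q1, q2]; norm_num⟩

end Hypergraph

/-! ### Incidence graphs and cycles -/

namespace Hypergraph

variable {V : Type*}

/-- The vertex-edge incidences of a hypergraph. -/
def incidences (H : Hypergraph V) : Set (V × Set V) := {p | p.2 ∈ E(H) ∧ p.1 ∈ p.2}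

/-- The bipartite graph on vertices and edges whose edges are the incidences in `J`. -/
def incGraph (H : Hypergraph V) (J : Set (V × Set V)) : SimpleGraph (V ⊕ E(H)) where
  Adj a b := match a, b with
    | .inl x, .inr f => (x, f.1) ∈ J
    | .inr f, .inl x => (x, f.1) ∈ J
    | _, _ => False
  symm := ⟨by rintro (a | a) (b | b) h <;> exact h⟩
  loopless := ⟨by rintro (a | a) h <;> exact h⟩

@[simp] theorem incGraph_not_adj_inl_inl {H : Hypergraph V} {J : Set (V × Set V)} {x y : V} :
    ¬ (H.incGraph J).Adj (.inl x) (.inl y) := id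

@[simp] theorem incGraph_not_adj_inr_inr {H : Hypergraph V} {J : Set (V × Set V)} {f g : E(H)} :
    ¬ (H.incGraph J).Adj (.inr f) (.inr g) := id

theorem card_edgeSet_incGraph {H : Hypergraph V} {J : Set (V × Set V)} (hJ : J ⊆ H.incidences) :
    Nat.card (H.incGraph J).edgeSet = J.ncard := by
  symm
  refine Set.ncard_congr (fun p hp => s(.inl p.1, .inr ⟨p.2, (hJ hp).1⟩)) ?_ ?_ ?_
  · intro p hp
    exact hp
  · rintro ⟨x, f⟩ ⟨y, g⟩ hp hq h
    simpa using h
  · intro s hs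
    induction s with
    | h a b =>
      rcases a with x | f <;> rcases b with y | g
      · exact False.elim hs
      · exact ⟨(x, g.1), hs, rfl⟩
      · exact ⟨(y, f.1), hs, Sym2.eq_swap⟩
      · exact False.elim hs

/-- Walks may be rerouted one step at a time, so it is enough to join the ends of each old
incidence. This is used to delete incidences. -/
theorem incGraph_connected_of_reachable {H : Hypergraph V} {J J' : Set (V × Set V)}
    (hJ : (H.incGraph J).Connected)
    (h : ∀ x (f : E(H)), (x, f.1) ∈ J → (H.incGraph J').Reachable (.inl x) (.inr f)) :
    (H.incGraph J').Connected := by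
  have hadj : ∀ a b, (H.incGraph J).Adj a b → (H.incGraph J').Reachable a b := by
    rintro (x | f) (y | g) hab
    · exact absurd hab incGraph_not_adj_inl_inl
    · exact h x g hab
    · exact (h y f hab).symm
    · exact absurd hab incGraph_not_adj_inr_inr
  have : Nonempty (V ⊕ E(H)) := hJ.nonempty
  refine SimpleGraph.Connected.mk fun a b => ?_
  obtain ⟨p⟩ := hJ.preconnected a b
  induction p with
  | nil => exact SimpleGraph.Reachable.refl _
  | cons hab _ ih => exact (hadj _ _ hab).trans ih

theorem incGraph_incidences_connected {H : Hypergraph V} [Nonempty V] (hs : H.IsSpanning)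
    (hc : H.IsConnected) (hne : ∀ f ∈ E(H), f.Nonempty) :
    (H.incGraph H.incidences).Connected := by
  have step : ∀ x f (hf : f ∈ E(H)), x ∈ f →
      (H.incGraph H.incidences).Reachable (.inl x) (.inr ⟨f, hf⟩) := fun x f hf hx =>
    SimpleGraph.Adj.reachable ⟨hf, hx⟩
  have hV : ∀ x y : V, (H.incGraph H.incidences).Reachable (.inl x) (.inl y) := by
    intro x y
    have := hc x (by rw [hs]; trivial) y (by rw [hs]; trivial)
    induction this with
    | refl => exact SimpleGraph.Reachable.refl _
    | tail _ hab ih =>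
      obtain ⟨f, hf, ha, hb⟩ := hab
      exact ih.trans ((step _ f hf ha).trans (step _ f hf hb).symm)
  obtain ⟨x₀⟩ := ‹Nonempty V›
  have : Nonempty (V ⊕ E(H)) := ⟨.inl x₀⟩
  have h0 : ∀ a, (H.incGraph H.incidences).Reachable (.inl x₀) a := by
    rintro (x | ⟨f, hf⟩)
    · exact hV _ _
    · obtain ⟨x, hx⟩ := hne f hf
      exact (hV x₀ x).trans (step x f hf hx)
  exact SimpleGraph.Connected.mk fun a b => (h0 a).symm.trans (h0 b)

theorem finRotate_ne {m : ℕ} (hm : 2 ≤ m) (i : Fin m) : finRotate m i ≠ i := by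
  have : i ∈ (finRotate m).support := by rw [support_finRotate_of_le hm]; simp
  exact Equiv.Perm.mem_support.mp this

theorem finRotate_induction {m : ℕ} (hm : 2 ≤ m) {p : Fin m → Prop} {i : Fin m} (hi : p i)
    (h : ∀ j, p j → p (finRotate m j)) (j : Fin m) : p j := by
  obtain ⟨t, rfl⟩ := (isCycle_finRotate_of_le hm).exists_pow_eq (finRotate_ne hm i)
    (finRotate_ne hm j)
  induction t with
  | zero => simpa
  | succ t ih => rw [pow_succ']; exact h _ ih

theorem coe_finRotate_eq_ite {m : ℕ} (i : Fin m) :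
    (finRotate m i : ℕ) = if (i : ℕ) + 1 = m then 0 else (i : ℕ) + 1 := by
  obtain _ | m := m
  · exact i.elim0
  · rw [coe_finRotate]
    simp [Fin.ext_iff]

section Cycle

variable {H : Hypergraph V} {m : ℕ} {v : Fin m → V} {e : Fin m → Set V}

theorem cycleIncidences_subset (hC : H.IsCycle v e) : cycleIncidences v e ⊆ H.incidences := by
  rintro p ⟨i, rfl | rfl⟩
  · exact ⟨hC.edge_mem i, hC.left_mem i⟩
  · exact ⟨hC.edge_mem i, hC.right_mem i⟩

/-- Deleting one incidence of a cycle does not disconnect the cycle. -/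
theorem reachable_of_mem_cycleIncidences (hC : H.IsCycle v e) {p : V × Set V}
    (hp : p ∈ cycleIncidences v e) {J : Set (V × Set V)} (hJ : cycleIncidences v e \ {p} ⊆ J) :
    (∀ i j, (H.incGraph J).Reachable (.inl (v i)) (.inl (v j))) ∧
    (∀ i j, (H.incGraph J).Reachable (.inl (v i)) (.inr ⟨e j, hC.edge_mem j⟩)) := by
  set G := H.incGraph J
  have hm := hC.two_le
  have left : ∀ j, (v j, e j) ≠ p → G.Reachable (.inl (v j)) (.inr ⟨e j, hC.edge_mem j⟩) :=
    fun j hj => SimpleGraph.Adj.reachable (hJ ⟨⟨j, Or.inl rfl⟩, hj⟩)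
  have right : ∀ j, (v (finRotate m j), e j) ≠ p →
      G.Reachable (.inl (v (finRotate m j))) (.inr ⟨e j, hC.edge_mem j⟩) :=
    fun j hj => SimpleGraph.Adj.reachable (hJ ⟨⟨j, Or.inr rfl⟩, hj⟩)
  obtain ⟨i, hi⟩ := hp
  have hpe : p.2 = e i := by rcases hi with rfl | rfl <;> rfl
  have step : ∀ j, j ≠ i → G.Reachable (.inl (v j)) (.inl (v (finRotate m j))) := by
    intro j hj
    have : ∀ x, (x, e j) ≠ p := fun x h => hj (hC.edge_injective (by rw [← hpe, ← h]))
    exact (left j (this _)).trans (right j (this _)).symm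
  -- Go round the cycle from `v (finRotate m i)`. The only step that might fail leaves `v i`; were
  -- `v i` unreachable, that step would never be needed and the induction would reach `v i` after
  -- all.
  have hvi : G.Reachable (.inl (v (finRotate m i))) (.inl (v i)) := by
    by_contra hcon
    refine hcon (finRotate_induction hm
      (p := fun j => G.Reachable (.inl (v (finRotate m i))) (.inl (v j)))
      (SimpleGraph.Reachable.refl _) (fun j hj => ?_) i)
    by_cases hji : j = i
    · exact absurd (hji ▸ hj) hcon
    · exact hj.trans (step j hji)
  have hV : ∀ j, G.Reachable (.inl (v (finRotate m i))) (.inl (v j)) := by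
    refine finRotate_induction hm
      (p := fun j => G.Reachable (.inl (v (finRotate m i))) (.inl (v j)))
      (SimpleGraph.Reachable.refl _) (fun j hj => ?_)
    by_cases hji : j = i
    · rw [hji]
    · exact hj.trans (step j hji)
  have hVV : ∀ i j, G.Reachable (.inl (v i)) (.inl (v j)) := fun i j => (hV i).symm.trans (hV j)
  refine ⟨hVV, fun a j => ?_⟩
  by_cases hj : (v j, e j) = p
  · have : (v (finRotate m j), e j) ≠ p := by
      rw [← hj]
      intro h
      exact finRotate_ne hm j (hC.vertex_injective (congrArg Prod.fst h))
    exact (hVV a _).trans (right j this)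
  · exact (hVV a _).trans (left j hj)

theorem reachable_of_mem_cycleIncidences' (hC : H.IsCycle v e) {p : V × Set V}
    (hp : p ∈ cycleIncidences v e) {J : Set (V × Set V)} (hJ : cycleIncidences v e \ {p} ⊆ J)
    {x : V} {f : E(H)} (hq : (x, f.1) ∈ cycleIncidences v e) :
    (H.incGraph J).Reachable (.inl x) (.inr f) := by
  have h := (reachable_of_mem_cycleIncidences hC hp hJ).2
  obtain ⟨f, hf⟩ := f
  obtain ⟨j, hj | hj⟩ := hq
  all_goals
    obtain ⟨rfl, rfl⟩ := Prod.mk.inj hj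
    exact h _ _

end Cycle

/-- A cycle of an incidence graph is a cycle of the hypergraph. -/
theorem exists_isCycle_of_not_isAcyclic {H : Hypergraph V} {J : Set (V × Set V)}
    (hJ : J ⊆ H.incidences) (h : ¬ (H.incGraph J).IsAcyclic) :
    ∃ (m : ℕ) (v : Fin m → V) (e : Fin m → Set V), H.IsCycle v e ∧ cycleIncidences v e ⊆ J := by
  classical
  set G := H.incGraph J with hG
  obtain ⟨x₀, c, hc⟩ : ∃ (x : V) (c : G.Walk (.inl x) (.inl x)), c.IsCycle := by
    simp only [SimpleGraph.IsAcyclic, not_forall, not_not] at h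
    obtain ⟨a, c, hc⟩ := h
    -- A closed walk based at a hyperedge is rotated to start at its next node, which is a vertex.
    rcases a with x | f
    · exact ⟨x, c, hc⟩
    · have hadj := c.adj_getVert_succ (i := 0) (by have := hc.three_le_length; omega)
      rw [SimpleGraph.Walk.getVert_zero] at hadj
      rcases hb : c.getVert (0 + 1) with x | g
      · have hx : Sum.inl x ∈ c.support := by
          rw [← hb]
          exact c.getVert_mem_support _
        exact ⟨x, c.rotate _ hx, hc.rotate hx⟩
      · rw [hb] at hadj
        exact absurd hadj incGraph_not_adj_inr_inr
  have hlen := hc.three_le_length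
  have alt : ∀ i, (2 * i ≤ c.length → ∃ x, c.getVert (2 * i) = .inl x) ∧
      (2 * i + 1 ≤ c.length → ∃ f, c.getVert (2 * i + 1) = .inr f) := by
    have fromL : ∀ k x, k + 1 ≤ c.length → c.getVert k = .inl x →
        ∃ f, c.getVert (k + 1) = .inr f := by
      intro k x hk hx
      have hadj := c.adj_getVert_succ (i := k) (by omega)
      rw [hx] at hadj
      rcases hb : c.getVert (k + 1) with y | g
      · rw [hb] at hadj
        exact absurd hadj incGraph_not_adj_inl_inl
      · exact ⟨g, rfl⟩
    have fromR : ∀ k f, k + 1 ≤ c.length → c.getVert k = .inr f →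
        ∃ x, c.getVert (k + 1) = .inl x := by
      intro k f hk hf
      have hadj := c.adj_getVert_succ (i := k) (by omega)
      rw [hf] at hadj
      rcases hb : c.getVert (k + 1) with y | g
      · exact ⟨y, rfl⟩
      · rw [hb] at hadj
        exact absurd hadj incGraph_not_adj_inr_inr
    intro i
    induction i with
    | zero =>
      have h0 : c.getVert (2 * 0) = .inl x₀ := c.getVert_zero
      exact ⟨fun _ => ⟨x₀, h0⟩, fun h => fromL _ _ h h0⟩
    | succ i ih =>
      have hL : 2 * (i + 1) ≤ c.length → ∃ x, c.getVert (2 * (i + 1)) = .inl x := by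
        intro h
        obtain ⟨f, hf⟩ := ih.2 (by omega)
        exact fromR _ f h hf
      refine ⟨hL, fun h => ?_⟩
      obtain ⟨x, hx⟩ := hL (by omega)
      exact fromL _ x h hx
  obtain ⟨m, hm⟩ : ∃ m, c.length = 2 * m := by
    rcases Nat.even_or_odd' c.length with ⟨m, hm | hm⟩
    · exact ⟨m, hm⟩
    · obtain ⟨f, hf⟩ := (alt m).2 hm.ge
      rw [← hm, c.getVert_length] at hf
      cases hf
  choose v hv using fun i : Fin m => (alt i).1 (by omega)
  choose e he using fun i : Fin m => (alt i).2 (by omega)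
  -- At the last index the next even position is `c.length`, where the closed walk is back at its
  -- start; this is the wrap-around of `finRotate`.
  have hnext : ∀ i : Fin m, c.getVert (2 * (i : ℕ) + 1 + 1) = .inl (v (finRotate m i)) := by
    intro i
    rw [← hv, coe_finRotate_eq_ite]
    split_ifs with hi
    · rw [show 2 * (i : ℕ) + 1 + 1 = c.length by omega, c.getVert_length]
      exact c.getVert_zero.symm
    · rfl
  have hl : ∀ i : Fin m, (v i, (e i).1) ∈ J := by
    intro i
    have := c.adj_getVert_succ (i := 2 * (i : ℕ)) (by omega)
    rwa [hv, he] at this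
  have hr : ∀ i : Fin m, (v (finRotate m i), (e i).1) ∈ J := by
    intro i
    have := c.adj_getVert_succ (i := 2 * (i : ℕ) + 1) (by omega)
    rwa [hnext, he] at this
  refine ⟨m, v, fun i => (e i).1, ⟨by omega, ?_, ?_, fun i => (e i).2, fun i => (hJ (hl i)).2,
    fun i => (hJ (hr i)).2⟩, ?_⟩
  · intro i j hij
    have h1 : c.getVert (2 * (i : ℕ)) = c.getVert (2 * (j : ℕ)) := by rw [hv, hv, hij]
    have := hc.getVert_injOn' (show 2 * (i : ℕ) ≤ c.length - 1 by omega)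
      (show 2 * (j : ℕ) ≤ c.length - 1 by omega) h1
    exact Fin.ext (by omega)
  · intro i j hij
    have h1 : c.getVert (2 * (i : ℕ) + 1) = c.getVert (2 * (j : ℕ) + 1) := by
      rw [he, he, Subtype.ext hij]
    have := hc.getVert_injOn' (show 2 * (i : ℕ) + 1 ≤ c.length - 1 by omega)
      (show 2 * (j : ℕ) + 1 ≤ c.length - 1 by omega) h1
    exact Fin.ext (by omega)
  · rintro p ⟨i, rfl | rfl⟩
    exacts [hl i, hr i]

end Hypergraph

/-! ### Counting incidences and stability of the class under moves -/

namespace Hypergraph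

variable {V : Type*} {H : Hypergraph V}

theorem incGraph_sdiff_singleton_connected (hcon : (H.incGraph H.incidences).Connected)
    {m : ℕ} {v : Fin m → V} {e : Fin m → Set V}
    (hC : H.IsCycle v e) {p : V × Set V} (hp : p ∈ cycleIncidences v e) :
    (H.incGraph (H.incidences \ {p})).Connected := by
  refine incGraph_connected_of_reachable hcon fun x f hxf => ?_
  by_cases hq : (x, f.1) = p
  · exact reachable_of_mem_cycleIncidences' hC hp
      (Set.sdiff_subset_sdiff_left (cycleIncidences_subset hC)) (hq ▸ hp)
  · exact SimpleGraph.Adj.reachable ⟨hxf, hq⟩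

section Counting

variable [Finite V] {m : ℕ} {v : Fin m → V} {e : Fin m → Set V}

theorem card_le_ncard_add_one {J : Set (V × Set V)} (hJ : J ⊆ H.incidences)
    (h : (H.incGraph J).Connected) : Nat.card V + E(H).ncard ≤ J.ncard + 1 := by
  have := h.card_vert_le_card_edgeSet_add_one
  rwa [card_edgeSet_incGraph hJ, Nat.card_sum] at this

/-- In a unicyclic hypergraph the incidences are as many as the vertices and edges together. -/
theorem ncard_incidences_of_unique (hcon : (H.incGraph H.incidences).Connected)
    (hC : H.IsCycle v e)
    (huniq : ∀ (m' : ℕ) (v' : Fin m' → V) (e' : Fin m' → Set V), H.IsCycle v' e' →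
      cycleIncidences v' e' = cycleIncidences v e) :
    H.incidences.ncard = Nat.card V + E(H).ncard := by
  have hm := hC.two_le
  set p : V × Set V := (v ⟨0, by omega⟩, e ⟨0, by omega⟩) with hp'
  have hp : p ∈ cycleIncidences v e := ⟨_, Or.inl rfl⟩
  -- Without `p` the graph stays connected. A remaining cycle would give a cycle of `H`, which by
  -- uniqueness has the same incidences as the given one and hence uses `p`.
  have htree : (H.incGraph (H.incidences \ {p})).IsTree := by
    refine ⟨incGraph_sdiff_singleton_connected hcon hC hp, ?_⟩
    by_contra hcyc
    obtain ⟨m', v', e', hC', hsub⟩ := exists_isCycle_of_not_isAcyclic Set.sdiff_subset hcyc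
    rw [huniq m' v' e' hC'] at hsub
    exact (hsub hp).2 rfl
  have hcard := (SimpleGraph.isTree_iff_connected_and_card.mp htree).2
  rw [card_edgeSet_incGraph Set.sdiff_subset, Nat.card_sum] at hcard
  have := Set.ncard_sdiff_singleton_add_one (cycleIncidences_subset hC hp)
  change _ = Nat.card V + Nat.card E(H)
  omega

/-- With this number of incidences, deleting a cycle incidence leaves a tree: no further incidence
can be deleted without disconnecting its ends. -/
theorem not_reachable_of_ncard_incidences (hcon : (H.incGraph H.incidences).Connected)
    (hcard : H.incidences.ncard = Nat.card V + E(H).ncard)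
    (hC : H.IsCycle v e) {p : V × Set V} (hp : p ∈ cycleIncidences v e) {x : V} {f : E(H)}
    (hx : x ∈ f.1) (hne : (x, f.1) ≠ p) :
    ¬ (H.incGraph (H.incidences \ {p, (x, f.1)})).Reachable (.inl x) (.inr f) := by
  intro hreach
  have h2 : (H.incGraph (H.incidences \ {p, (x, f.1)})).Connected := by
    refine incGraph_connected_of_reachable (incGraph_sdiff_singleton_connected hcon hC hp)
      fun y g hyg => ?_
    by_cases hq : (y, g.1) = (x, f.1)
    · obtain ⟨rfl, h⟩ := Prod.mk.inj hq
      obtain rfl : g = f := Subtype.ext h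
      exact hreach
    · refine SimpleGraph.Adj.reachable ⟨hyg.1, ?_⟩
      rintro (h | h)
      exacts [hyg.2 h, hq h]
  have h3 := card_le_ncard_add_one Set.sdiff_subset h2
  have hsub : ({p, (x, f.1)} : Set (V × Set V)) ⊆ H.incidences := by
    rintro q (rfl | rfl)
    exacts [cycleIncidences_subset hC hp, ⟨f.2, hx⟩]
  have h4 := Set.ncard_sdiff_add_ncard_of_subset hsub
  rw [Set.ncard_pair hne.symm] at h4
  omega

/-- If `p` belonged to the first cycle only, one could delete `p` and then an incidence of the
second cycle, whose ends stay joined along the rest of that cycle. By the count no such second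
deletion is possible. -/
theorem cycleIncidences_subset_of_ncard (hcon : (H.incGraph H.incidences).Connected)
    (hcard : H.incidences.ncard = Nat.card V + E(H).ncard) (hC : H.IsCycle v e)
    {m' : ℕ} {v' : Fin m' → V} {e' : Fin m' → Set V} (hC' : H.IsCycle v' e') :
    cycleIncidences v e ⊆ cycleIncidences v' e' := by
  intro p hp
  by_contra hp'
  have hm' := hC'.two_le
  set j : Fin m' := ⟨0, by omega⟩
  have hq : (v' j, e' j) ∈ cycleIncidences v' e' := ⟨_, Or.inl rfl⟩
  refine not_reachable_of_ncard_incidences hcon hcard hC hp (f := ⟨e' j, hC'.edge_mem j⟩)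
    (hC'.left_mem j) (fun h => hp' (h ▸ hq)) ?_
  refine reachable_of_mem_cycleIncidences' hC' hq ?_ hq
  rintro r ⟨hr, hrq⟩
  refine ⟨cycleIncidences_subset hC' hr, ?_⟩
  rintro (h | h)
  exacts [hp' (h ▸ hr), hrq h]

theorem isUnicyclic_of_ncard (hc : H.IsConnected)
    (hcon : (H.incGraph H.incidences).Connected)
    (hcard : H.incidences.ncard = Nat.card V + E(H).ncard) (hC : H.IsCycle v e) :
    H.IsUnicyclic :=
  ⟨hc, ⟨m, v, e, hC⟩, fun _ _ _ _ _ _ h h' =>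
    (cycleIncidences_subset_of_ncard hcon hcard h h').antisymm
      (cycleIncidences_subset_of_ncard hcon hcard h' h)⟩

theorem ncard_incidences_of_isUniform {k : ℕ} (hk : H.IsUniform k) :
    H.incidences.ncard = E(H).ncard * k := by
  classical
  have := Fintype.ofFinite E(H)
  let φ : H.incidences ≃ Σ f : E(H), f.1 :=
    { toFun := fun p => ⟨⟨p.1.2, p.2.1⟩, ⟨p.1.1, p.2.2⟩⟩
      invFun := fun q => ⟨(q.2.1, q.1.1), q.1.2, q.2.2⟩
      left_inv := fun _ => rfl
      right_inv := fun _ => rfl }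
  have h1 : H.incidences.ncard = Nat.card (Σ f : E(H), f.1) := Nat.card_congr φ
  rw [h1, Nat.card_sigma, Finset.sum_congr rfl (g := fun _ => k) fun f _ => hk f.1 f.2]
  rw [Finset.sum_const, smul_eq_mul, Finset.card_univ, ← Nat.card_eq_fintype_card]
  rfl

/-- A vertex of the cycle on an edge of the cycle is one of its two ends. -/
theorem mem_cycleIncidences_of_mem (hcon : (H.incGraph H.incidences).Connected)
    (hcard : H.incidences.ncard = Nat.card V + E(H).ncard) (hC : H.IsCycle v e) {i j : Fin m}
    (h : v i ∈ e j) : (v i, e j) ∈ cycleIncidences v e := by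
  by_contra hn
  have hp : (v j, e j) ∈ cycleIncidences v e := ⟨_, Or.inl rfl⟩
  refine not_reachable_of_ncard_incidences hcon hcard hC hp (f := ⟨e j, hC.edge_mem j⟩) h
    (fun h => hn (h ▸ hp)) ((reachable_of_mem_cycleIncidences hC hp ?_).2 i j)
  rintro r ⟨hr, hrq⟩
  refine ⟨cycleIncidences_subset hC hr, ?_⟩
  rintro (h | h)
  exacts [hrq h, hn (h ▸ hr)]

/-- An edge outside the cycle has at most one vertex on the cycle. -/
theorem eq_of_mem_of_notMem_range (hcon : (H.incGraph H.incidences).Connected)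
    (hcard : H.incidences.ncard = Nat.card V + E(H).ncard) (hC : H.IsCycle v e) {i j : Fin m}
    {f : Set V} (hf : f ∈ E(H)) (hfe : f ∉ Set.range e) (hi : v i ∈ f) (hj : v j ∈ f) :
    i = j := by
  by_contra hij
  have hp : (v j, e j) ∈ cycleIncidences v e := ⟨_, Or.inl rfl⟩
  have hn : ∀ q ∈ cycleIncidences v e, q.2 ≠ f := by
    rintro q ⟨l, rfl | rfl⟩ h <;> exact hfe ⟨l, h⟩
  refine not_reachable_of_ncard_incidences hcon hcard hC hp (f := ⟨f, hf⟩) hi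
    (fun h => hn _ hp (congrArg Prod.snd h).symm)
    (((reachable_of_mem_cycleIncidences hC hp ?_).1 i j).trans
      (SimpleGraph.Adj.reachable ⟨⟨hf, hj⟩, ?_⟩))
  · rintro r ⟨hr, hrq⟩
    refine ⟨cycleIncidences_subset hC hr, ?_⟩
    rintro (h | h)
    exacts [hrq h, hn r hr (congrArg Prod.snd h)]
  · rintro (h | h)
    · exact hn _ hp (congrArg Prod.snd h).symm
    · exact hij (hC.vertex_injective (congrArg Prod.fst h)).symm

end Counting

theorem isCycle_two {x y : V} {f g : Set V} (hf : f ∈ E(H)) (hg : g ∈ E(H)) (hxy : x ≠ y)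
    (hfg : f ≠ g) (h1 : x ∈ f) (h2 : y ∈ f) (h3 : x ∈ g) (h4 : y ∈ g) :
    H.IsCycle ![x, y] ![f, g] := by
  refine ⟨le_rfl, ?_, ?_, ?_, ?_, ?_⟩
  · intro i j
    fin_cases i <;> fin_cases j <;> simp [hxy, hxy.symm]
  · intro i j
    fin_cases i <;> fin_cases j <;> simp [hfg, hfg.symm]
  all_goals
    intro i
    fin_cases i <;> simp [*]

theorem isCycle_three {x y z : V} {f g h : Set V} (hf : f ∈ E(H)) (hg : g ∈ E(H)) (hh : h ∈ E(H))
    (hxy : x ≠ y) (hyz : y ≠ z) (hxz : x ≠ z) (hfg : f ≠ g) (hgh : g ≠ h) (hfh : f ≠ h)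
    (h1 : x ∈ f) (h2 : y ∈ f) (h3 : y ∈ g) (h4 : z ∈ g) (h5 : z ∈ h) (h6 : x ∈ h) :
    H.IsCycle ![x, y, z] ![f, g, h] := by
  refine ⟨by norm_num, ?_, ?_, ?_, ?_, ?_⟩
  · intro i j
    fin_cases i <;> fin_cases j <;> simp [hxy, hxy.symm, hyz, hyz.symm, hxz, hxz.symm]
  · intro i j
    fin_cases i <;> fin_cases j <;> simp [hfg, hfg.symm, hgh, hgh.symm, hfh, hfh.symm]
  · intro i
    fin_cases i <;> simp [*]
  · intro i
    fin_cases i <;> simp [*]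
  · intro i
    fin_cases i
    · simpa [finRotate_apply] using h2
    · simpa [finRotate_apply] using h4
    · simpa [finRotate_apply] using h6

section OffCycle

variable {m : ℕ} {v : Fin m → V} {e : Fin m → Set V}

/-- Cycle incidences determine the cycle vertices, so any cycle exhibited through a vertex off the
given one is a contradiction. The next two lemmas use this for cycles of length two and three. -/
theorem IsUnicyclic.range_eq {m' : ℕ} {v' : Fin m' → V} {e' : Fin m' → Set V}
    (hU : H.IsUnicyclic) (hC : H.IsCycle v e) (hC' : H.IsCycle v' e') :
    Set.range v = Set.range v' := by
  have hr : ∀ {m : ℕ} (v : Fin m → V) (e : Fin m → Set V),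
      Set.range v = Prod.fst '' cycleIncidences v e := by
    intro m v e
    ext x
    constructor
    · rintro ⟨i, rfl⟩
      exact ⟨_, ⟨i, Or.inl rfl⟩, rfl⟩
    · rintro ⟨_, ⟨i, rfl | rfl⟩, rfl⟩ <;> exact ⟨_, rfl⟩
  rw [hr v e, hr v' e', hU.2.2 m m' v e v' e' hC hC']

/-- Two edges through a vertex off the cycle share no other vertex. -/
theorem IsUnicyclic.edge_eq_of_notMem_range (hU : H.IsUnicyclic) (hC : H.IsCycle v e) {w x : V}
    (hw : w ∉ Set.range v) (hxw : x ≠ w) {f g : Set V} (hf : f ∈ E(H)) (hg : g ∈ E(H))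
    (hwf : w ∈ f) (hxf : x ∈ f) (hwg : w ∈ g) (hxg : x ∈ g) : f = g := by
  by_contra hfg
  refine hw ?_
  rw [hU.range_eq hC (isCycle_two hf hg hxw.symm hfg hwf hxf hwg hxg)]
  exact ⟨0, rfl⟩

/-- No triangle passes through a vertex off the cycle. -/
theorem IsUnicyclic.false_of_triangle (hU : H.IsUnicyclic) (hC : H.IsCycle v e) {w x y : V}
    (hw : w ∉ Set.range v) (hxw : x ≠ w) (hyw : y ≠ w) (hxy : x ≠ y) {f g h : Set V}
    (hf : f ∈ E(H)) (hg : g ∈ E(H)) (hh : h ∈ E(H)) (hfg : f ≠ g) (hgh : g ≠ h) (hfh : f ≠ h)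
    (h1 : w ∈ f) (h2 : x ∈ f) (h3 : x ∈ g) (h4 : y ∈ g) (h5 : y ∈ h) (h6 : w ∈ h) : False := by
  refine hw ?_
  rw [hU.range_eq hC (isCycle_three hf hg hh hxw.symm hxy hyw.symm hfg hgh hfh h1 h2 h3 h4 h5 h6)]
  exact ⟨0, rfl⟩

end OffCycle

section Shift

variable {F : Set (Set V)} {w z : V}

/-- Replacing `w` by `z` is reversible on edges that contain `w` and not `z`, so only a moved and an
unmoved edge could collide. -/
theorem injOn_moveEdge (hF : ∀ f ∈ F, w ∈ f ∧ z ∉ f)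
    (h : ∀ f ∈ F, ∀ g ∈ E(H), g ∉ F → insert z (f \ {w}) ≠ g) :
    Set.InjOn (moveEdge F w z) E(H) := by
  intro f hf g hg hfg
  by_cases h1 : f ∈ F <;> by_cases h2 : g ∈ F
  · simp only [moveEdge, h1, h2, if_true] at hfg
    ext x
    by_cases hxw : x = w
    · subst hxw
      simp [(hF f h1).1, (hF g h2).1]
    · by_cases hxz : x = z
      · subst hxz
        simp [(hF f h1).2, (hF g h2).2]
      · have := Set.ext_iff.mp hfg x
        simpa [hxw, hxz] using this
  · simp only [moveEdge, h1, h2, if_true, if_false] at hfg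
    exact absurd hfg (h f h1 g hg h2)
  · simp only [moveEdge, h1, h2, if_true, if_false] at hfg
    exact absurd hfg.symm (h g h2 f hf h1)
  · simpa only [moveEdge, h1, h2, if_false] using hfg

theorem isCycle_shift {m : ℕ} {v : Fin m → V} {e : Fin m → Set V} (hC : H.IsCycle v e)
    (hw : w ∉ Set.range v) (hinj : Set.InjOn (moveEdge F w z) E(H)) :
    (H.shift F w z).IsCycle v (fun i => moveEdge F w z (e i)) := by
  have hne : ∀ i, v i ≠ w := fun i h => hw ⟨i, h⟩
  exact ⟨hC.two_le, hC.vertex_injective,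
    fun i j hij => hC.edge_injective (hinj (hC.edge_mem i) (hC.edge_mem j) hij),
    fun i => moveEdge_mem_shift (hC.edge_mem i),
    fun i => mem_moveEdge_of_mem_of_ne (hC.left_mem i) (hne _),
    fun i => mem_moveEdge_of_mem_of_ne (hC.right_mem i) (hne _)⟩

/-- A moved edge still joins its vertices other than `w` to `z`, so only a connection between `w`
and `z` has to be supplied. -/
theorem isConnected_shift (hs : H.IsSpanning) (hc : H.IsConnected)
    (hwz : Relation.ReflTransGen (H.shift F w z).Adj w z) : (H.shift F w z).IsConnected := by
  have hsymm : ∀ a b, Relation.ReflTransGen (H.shift F w z).Adj a b →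
      Relation.ReflTransGen (H.shift F w z).Adj b a := by
    have : Std.Symm (H.shift F w z).Adj := ⟨fun _ _ h => h.symm⟩
    exact fun a b h => Std.Symm.symm a b h
  intro x _ y hy
  clear hy
  have := hc x (by rw [hs]; trivial) y (by rw [hs]; trivial)
  induction this with
  | refl => exact Relation.ReflTransGen.refl
  | @tail a b _ hab ih =>
    refine ih.trans ?_
    obtain ⟨f, hf, ha, hb⟩ := hab
    by_cases hfF : f ∈ F
    · have toz : ∀ c ∈ f, Relation.ReflTransGen (H.shift F w z).Adj c z := by
        intro c hc
        by_cases hcw : c = w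
        · rwa [hcw]
        · exact Relation.ReflTransGen.single ⟨_, moveEdge_mem_shift hf,
            mem_moveEdge_of_mem_of_ne hc hcw, by simp [mem_moveEdge_of_mem hfF]⟩
      exact (toz a ha).trans (hsymm _ _ (toz b hb))
    · refine Relation.ReflTransGen.single ⟨f, ?_, ha, hb⟩
      rw [← moveEdge_of_notMem hfF (w := w) (z := z)]
      exact moveEdge_mem_shift hf

theorem isUniform_shift [Finite V] {k : ℕ} (hk : H.IsUniform k) (hF : ∀ f ∈ F, w ∈ f ∧ z ∉ f) :
    (H.shift F w z).IsUniform k := by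
  rintro _ ⟨f, hf, rfl⟩
  by_cases hfF : f ∈ F
  · simp only [moveEdge, hfF, if_true]
    rw [Set.ncard_exchange (hF f hfF).2 (hF f hfF).1]
    exact hk f hf
  · rw [moveEdge_of_notMem hfF]
    exact hk f hf

theorem incGraph_connected_of_mem_unicyclicClass [Fintype V] {k n : ℕ} (hk : 1 ≤ k) (hn : 1 ≤ n)
    (hH : H ∈ unicyclicClass V k n) : (H.incGraph H.incidences).Connected := by
  have : Nonempty V := Fintype.card_pos_iff.mp (by rw [hH.2.1]; omega)
  refine incGraph_incidences_connected hH.1 hH.2.2.2.1 fun f hf => ?_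
  rw [← Set.ncard_pos, hH.2.2.1 f hf]
  omega

theorem ncard_incidences_of_mem_unicyclicClass [Fintype V] {k n : ℕ} (hk : 1 ≤ k) (hn : 1 ≤ n)
    (hH : H ∈ unicyclicClass V k n) : H.incidences.ncard = Nat.card V + E(H).ncard := by
  have hcon := incGraph_connected_of_mem_unicyclicClass hk hn hH
  obtain ⟨m, v, e, hC⟩ := hH.2.2.2.2.1
  exact ncard_incidences_of_unique hcon hC fun m' v' e' hC' => hH.2.2.2.2.2 _ _ _ _ _ _ hC' hC

/-- Uniformity and the number of edges are kept, hence so is the incidence count; the cycle survives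
because `w` is not on it. -/
theorem shift_mem_unicyclicClass [Fintype V] {k n : ℕ} (hk : 1 ≤ k) (hn : 1 ≤ n)
    (hH : H ∈ unicyclicClass V k n) {m : ℕ} {v : Fin m → V} {e : Fin m → Set V}
    (hC : H.IsCycle v e) (hw : w ∉ Set.range v) (hF : ∀ f ∈ F, w ∈ f ∧ z ∉ f)
    (hinj : Set.InjOn (moveEdge F w z) E(H))
    (hwz : Relation.ReflTransGen (H.shift F w z).Adj w z) :
    H.shift F w z ∈ unicyclicClass V k n := by
  have hc := isConnected_shift hH.1 hH.2.2.2.1 hwz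
  have hu := isUniform_shift hH.2.2.1 hF
  have : Nonempty V := Fintype.card_pos_iff.mp (by rw [hH.2.1]; omega)
  have hcon : ((H.shift F w z).incGraph (H.shift F w z).incidences).Connected :=
    incGraph_incidences_connected rfl hc fun f hf => by
      rw [← Set.ncard_pos, hu f hf]
      omega
  have hE : E(H.shift F w z).ncard = E(H).ncard := hinj.ncard_image
  refine ⟨rfl, hH.2.1, hu, isUnicyclic_of_ncard hc hcon ?_ (isCycle_shift hC hw hinj)⟩
  rw [ncard_incidences_of_isUniform hu, hE, ← ncard_incidences_of_isUniform hH.2.2.1,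
    ncard_incidences_of_mem_unicyclicClass hk hn hH]

end Shift

end Hypergraph

/-! ### Maximisers have no branching off the cycle -/

namespace Hypergraph

variable {V : Type*} {H : Hypergraph V}

theorem IsUniform.exists_mem_ne {k : ℕ} (hH : H.IsUniform k) (hk : 2 ≤ k) {f : Set V}
    (hf : f ∈ E(H)) (w : V) : ∃ x ∈ f, x ≠ w := by
  have hcard := hH f hf
  obtain ⟨a, b, ha, hb, hab⟩ := (Set.one_lt_ncard_iff (Set.finite_of_ncard_pos (by omega))).mp
    (show 1 < f.ncard by omega)
  by_cases h : a = w
  · exact ⟨b, hb, fun h' => hab (h.trans h'.symm)⟩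
  · exact ⟨a, ha, h⟩

theorem eq_of_degree_eq_one {x : V} (h : H.degree x = 1) {f g : Set V} (hf : f ∈ E(H))
    (hg : g ∈ E(H)) (hxf : x ∈ f) (hxg : x ∈ g) : f = g := by
  obtain ⟨a, ha⟩ := Set.ncard_eq_one.mp h
  have h1 : f ∈ ({a} : Set (Set V)) := ha ▸ ⟨hf, hxf⟩
  have h2 : g ∈ ({a} : Set (Set V)) := ha ▸ ⟨hg, hxg⟩
  exact h1.trans h2.symm

variable [Fintype V]

/-- The structure of `C₂(p, 0)`: two edges sharing two vertices `u` and `c`, all edges pass through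
`u`, and only those two pass through `c`. -/
theorem exists_of_mem_extremalClass {k n : ℕ} (hH : H ∈ extremalClass V k n) :
    ∃ (u c : V) (f g : Set V), u ≠ c ∧ f ∈ E(H) ∧ g ∈ E(H) ∧ f ≠ g ∧ c ∈ f ∧ c ∈ g ∧
      (∀ a ∈ E(H), u ∈ a) ∧ (∀ a ∈ E(H), c ∈ a → a = f ∨ a = g) ∧
      (∀ x, x ≠ u → x ≠ c → ∀ a ∈ E(H), ∀ b ∈ E(H), x ∈ a → x ∈ b → a = b) := by
  obtain ⟨-, -, -, v, e, hC, -, hpend, hdeg, hp⟩ := hH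
  have hl := hC.left_mem
  have hr := hC.right_mem
  have r0 : finRotate 2 0 = 1 := by decide
  have r1 : finRotate 2 1 = 0 := by decide
  have h10 := hr 0
  have h01 := hr 1
  rw [r0] at h10
  rw [r1] at h01
  have hpend' : ∀ a ∈ E(H), a ∉ Set.range e → v 0 ∈ a ∧ v 1 ∉ a := by
    intro a ha hae
    have h1 : v 1 ∉ a := by
      intro h1
      have h0 := hp 1
      simp only [Matrix.cons_val_one, Matrix.cons_val_fin_one] at h0
      rw [Set.ncard_eq_zero] at h0
      exact Set.notMem_empty a (h0 ▸ ⟨ha, hae, h1⟩)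
    obtain ⟨i, hi⟩ := hpend a ha hae
    have hi' : v i ∈ a := (hi ▸ Set.mem_singleton (v i) : v i ∈ a ∩ Set.range v).1
    fin_cases i
    · exact ⟨hi', h1⟩
    · exact absurd hi' h1
  have hrange : ∀ a, a ∈ Set.range e → a = e 0 ∨ a = e 1 := by
    rintro _ ⟨i, rfl⟩
    fin_cases i <;> simp
  refine ⟨v 0, v 1, e 0, e 1, hC.vertex_injective.ne (by decide), hC.edge_mem 0, hC.edge_mem 1,
    hC.edge_injective.ne (by decide), h10, hl 1, ?_, ?_, ?_⟩
  · intro a ha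
    by_cases hae : a ∈ Set.range e
    · rcases hrange a hae with rfl | rfl
      exacts [hl 0, h01]
    · exact (hpend' a ha hae).1
  · intro a ha h1
    by_cases hae : a ∈ Set.range e
    · exact hrange a hae
    · exact absurd h1 (hpend' a ha hae).2
  · intro x hx0 hx1 a ha b hb hxa hxb
    refine eq_of_degree_eq_one (hdeg x ?_) ha hb hxa hxb
    rintro ⟨i, rfl⟩
    fin_cases i
    exacts [hx0 rfl, hx1 rfl]

/-- In `Xₙ` only the hub can lie in three edges: the other cycle vertex lies in two and every
remaining vertex in one. This is the test used below to show that a hypergraph is not `Xₙ`. -/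
theorem mem_of_mem_extremalClass {k n : ℕ} (hH : H ∈ extremalClass V k n) {x : V}
    {f₁ f₂ f₃ : Set V} (h1 : f₁ ∈ E(H)) (h2 : f₂ ∈ E(H)) (h3 : f₃ ∈ E(H)) (h12 : f₁ ≠ f₂)
    (h13 : f₁ ≠ f₃) (h23 : f₂ ≠ f₃) (hx1 : x ∈ f₁) (hx2 : x ∈ f₂) (hx3 : x ∈ f₃) {a : Set V}
    (ha : a ∈ E(H)) : x ∈ a := by
  obtain ⟨u, c, f, g, -, -, -, -, -, -, hu, hc, hother⟩ := exists_of_mem_extremalClass hH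
  by_cases hxu : x = u
  · exact hxu ▸ hu a ha
  · by_cases hxc : x = c
    · subst hxc
      have := hc _ h1 hx1
      have := hc _ h2 hx2
      have := hc _ h3 hx3
      grind
    · exact absurd (hother x hxu hxc _ h1 _ h2 hx1 hx2) h12

section Branch

variable {k n m : ℕ} {v : Fin m → V} {e : Fin m → Set V} {w u : V}

/-- Contracting towards `u`: if `w` is off the cycle and `e₀` is an edge through `w` and `u`, then
moving the other edges at `w` to `u` preserves the class and increases the Estrada index. -/
theorem shift_adjacent (hk : 2 ≤ k) (hn : 1 ≤ n) (hH : H ∈ unicyclicClass V k n)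
    (hC : H.IsCycle v e) (hw : w ∉ Set.range v) (huw : u ≠ w) {e₀ f₀ h : Set V}
    (he₀ : e₀ ∈ E(H)) (hwe : w ∈ e₀) (hue : u ∈ e₀) (hf₀ : f₀ ∈ E(H)) (hwf : w ∈ f₀)
    (huf : u ∉ f₀) (hh : h ∈ E(H)) (huh : u ∈ h) (hwh : w ∉ h) {F : Set (Set V)}
    (hF : F = {f ∈ E(H) | w ∈ f ∧ u ∉ f}) :
    Set.InjOn (moveEdge F w u) E(H) ∧ H.shift F w u ∈ unicyclicClass V k n ∧
      H.estradaIndex < (H.shift F w u).estradaIndex := by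
  have hU := hH.2.2.2
  have hF' : ∀ f ∈ F, w ∈ f ∧ u ∉ f := fun f hf => by rw [hF] at hf; exact hf.2
  have hFE : ∀ f ∈ F, f ∈ E(H) := fun f hf => by rw [hF] at hf; exact hf.1
  have hinj : Set.InjOn (moveEdge F w u) E(H) := by
    refine injOn_moveEdge hF' ?_
    rintro f hf _ hg - rfl
    obtain ⟨x, hxf, hxw⟩ := hH.2.2.1.exists_mem_ne hk (hFE f hf) w
    obtain ⟨hwf', huf'⟩ := hF' f hf
    -- If the moved copy of `f` were already an edge, it would form with `f` and `e₀` a triangle on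
    -- `w`, `x`, `u`.
    exact hU.false_of_triangle hC hw hxw huw (fun hxu => huf' (hxu ▸ hxf)) (hFE f hf) hg he₀
      (fun h => huf' (h ▸ Set.mem_insert u _))
      (fun h => by rw [← h] at hwe; simp [huw.symm] at hwe)
      (fun h => huf' (h ▸ hue)) hwf' hxf (Set.mem_insert_of_mem _ ⟨hxf, hxw⟩)
      (Set.mem_insert u _) hue hwe
  have he₀F : e₀ ∉ F := fun h => (hF' _ h).2 hue
  refine ⟨hinj, shift_mem_unicyclicClass (by omega) hn hH hC hw hF' hinj ?_, ?_⟩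
  · refine Relation.ReflTransGen.single ⟨e₀, ?_, hwe, hue⟩
    have := moveEdge_mem_shift (F := F) (w := w) (z := u) he₀
    rwa [moveEdge_of_notMem he₀F] at this
  · obtain ⟨o, ho, how⟩ := hH.2.2.1.exists_mem_ne hk hf₀ w
    obtain ⟨y, hy, hyu⟩ := hH.2.2.1.exists_mem_ne hk hh u
    exact estradaIndex_lt_shift_of_ne hF hinj (f₀ := f₀) (by rw [hF]; exact ⟨hf₀, hwf, huf⟩)
      ho how hh huh hwh hy hyu

/-- The structure of a hypergraph whose contraction towards `u` is `C₂(p, 0)`. -/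
theorem exists_of_shift_mem_extremalClass (hH : H ∈ unicyclicClass V k n)
    (hC : H.IsCycle v e) (hw : w ∉ Set.range v) (huw : u ≠ w) {e₀ f₀ h : Set V}
    (he₀ : e₀ ∈ E(H)) (hwe : w ∈ e₀) (hue : u ∈ e₀) (hf₀ : f₀ ∈ E(H)) (hwf : w ∈ f₀)
    (huf : u ∉ f₀) (hh : h ∈ E(H)) (huh : u ∈ h) (hwh : w ∉ h) {F : Set (Set V)}
    (hF : F = {f ∈ E(H) | w ∈ f ∧ u ∉ f}) (hinj : Set.InjOn (moveEdge F w u) E(H))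
    (hX : H.shift F w u ∈ extremalClass V k n) :
    ∃ (c : V) (f g : Set V), u ≠ c ∧ c ≠ w ∧ f ∈ E(H) ∧ g ∈ E(H) ∧ f ≠ g ∧ u ∈ f ∧ u ∈ g ∧
      c ∈ f ∧ c ∈ g ∧ (∀ a ∈ E(H), u ∈ a ∨ w ∈ a) ∧ (∀ a ∈ E(H), c ∈ a → a = f ∨ a = g) ∧
      (∀ x, x ≠ u → x ≠ c → x ≠ w → ∀ a ∈ E(H), ∀ b ∈ E(H), x ∈ a → x ∈ b → a = b) := by
  have hU := hH.2.2.2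
  have memF : ∀ {f}, f ∈ F ↔ f ∈ E(H) ∧ w ∈ f ∧ u ∉ f := fun {f} => by rw [hF]; rfl
  obtain ⟨u', c, f', g', huc, ⟨f, hf, rfl⟩, ⟨g, hg, rfl⟩, hfg', hcf', hcg', hu', hc', hother⟩ :=
    exists_of_mem_extremalClass hX
  have hfg : f ≠ g := fun h => hfg' (h ▸ rfl)
  have he₀F : e₀ ∉ F := fun h => (memF.mp h).2.2 hue
  have hhF : h ∉ F := fun h' => (memF.mp h').2.2 huh
  have hf₀F : f₀ ∈ F := memF.mpr ⟨hf₀, hwf, huf⟩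
  -- After the move `u` lies in three distinct edges, the images of `e₀`, `h` and `f₀`, so it lies
  -- in all of them.
  have hall : ∀ a ∈ E(H.shift F w u), u ∈ a := by
    intro a ha
    refine mem_of_mem_extremalClass hX (moveEdge_mem_shift he₀) (moveEdge_mem_shift hh)
      (moveEdge_mem_shift hf₀) (hinj.ne he₀ hh fun h' => hwh (h' ▸ hwe))
      (hinj.ne he₀ hf₀ fun h' => huf (h' ▸ hue)) (hinj.ne hh hf₀ fun h' => huf (h' ▸ huh))
      ?_ ?_ ?_ ha
    · rwa [moveEdge_of_notMem he₀F]
    · rwa [moveEdge_of_notMem hhF]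
    · simp [mem_moveEdge_of_mem hf₀F]
  obtain rfl : u = u' := by
    by_contra huu'
    have huc' : u ≠ c := by
      rintro rfl
      have h1 := hc' _ (moveEdge_mem_shift he₀) (hall _ (moveEdge_mem_shift he₀))
      have h2 := hc' _ (moveEdge_mem_shift hh) (hall _ (moveEdge_mem_shift hh))
      have h3 := hc' _ (moveEdge_mem_shift hf₀) (hall _ (moveEdge_mem_shift hf₀))
      have n1 := hinj.ne he₀ hh fun h' => hwh (h' ▸ hwe)
      have n2 := hinj.ne he₀ hf₀ fun h' => huf (h' ▸ hue)
      have n3 := hinj.ne hh hf₀ fun h' => huf (h' ▸ huh)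
      grind
    exact hinj.ne he₀ hh (fun h' => hwh (h' ▸ hwe)) (hother u huu' huc' _ (moveEdge_mem_shift he₀)
      _ (moveEdge_mem_shift hh) (hall _ (moveEdge_mem_shift he₀)) (hall _ (moveEdge_mem_shift hh)))
  have fixed : ∀ a ∈ E(H), a ∉ F → u ∈ a := fun a ha haF => by
    have := hall _ (moveEdge_mem_shift ha)
    rwa [moveEdge_of_notMem haF] at this
  have hcw : c ≠ w := by
    rintro rfl
    have key : ∀ a ∈ E(H), c ∈ moveEdge F c u a → u ∈ a ∧ c ∈ a := by
      intro a ha hca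
      have haF : a ∉ F := fun haF => by simp [mem_moveEdge_of_mem haF, huc.symm] at hca
      rw [moveEdge_of_notMem haF] at hca
      exact ⟨fixed a ha haF, hca⟩
    obtain ⟨h1, h2⟩ := key f hf hcf'
    obtain ⟨h3, h4⟩ := key g hg hcg'
    exact hfg (hU.edge_eq_of_notMem_range hC hw huw hf hg h2 h1 h4 h3)
  have hcf : c ∈ f := (mem_moveEdge_iff_of_ne hcw huc.symm).mp hcf'
  have hcg : c ∈ g := (mem_moveEdge_iff_of_ne hcw huc.symm).mp hcg'
  -- If `u ∉ a`, then `a` was moved and contains `w`. Then either `b` also contains `w`, and `a`,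
  -- `b` share `w` and `c`, or `b` contains `u`, and `a`, `b`, `e₀` form a triangle through `w`.
  have key : ∀ a ∈ E(H), ∀ b ∈ E(H), a ≠ b → c ∈ a → c ∈ b → u ∈ a := by
    intro a ha b hb hab hca hcb
    by_contra hua
    have haF : a ∈ F := by
      by_contra haF
      exact hua (fixed a ha haF)
    obtain ⟨-, hwa, -⟩ := memF.mp haF
    by_cases hwb : w ∈ b
    · exact hab (hU.edge_eq_of_notMem_range hC hw hcw ha hb hwa hca hwb hcb)
    · have hub : u ∈ b := fixed b hb fun hbF => hwb (memF.mp hbF).2.1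
      exact hU.false_of_triangle hC hw hcw huw huc.symm ha hb he₀ hab
        (fun h' => hwb (h' ▸ hwe)) (fun h' => hua (h' ▸ hue)) hwa hca hcb hub hue hwe
  refine ⟨c, f, g, huc, hcw, hf, hg, hfg, key f hf g hg hfg hcf hcg, key g hg f hf hfg.symm hcg hcf,
    hcf, hcg, ?_, ?_, ?_⟩
  · intro a ha
    by_cases haF : a ∈ F
    · exact Or.inr (memF.mp haF).2.1
    · exact Or.inl (fixed a ha haF)
  · intro a ha hca
    rcases hc' _ (moveEdge_mem_shift ha) ((mem_moveEdge_iff_of_ne hcw huc.symm).mpr hca) with h' | h'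
    · exact Or.inl (hinj ha hf h')
    · exact Or.inr (hinj ha hg h')
  · intro x hxu hxc hxw a ha b hb hxa hxb
    exact hinj ha hb (hother x hxu hxc _ (moveEdge_mem_shift ha) _ (moveEdge_mem_shift hb)
      ((mem_moveEdge_iff_of_ne hxw hxu).mpr hxa) ((mem_moveEdge_iff_of_ne hxw hxu).mpr hxb))

/-- From a vertex off the cycle some edge leads to a vertex with an edge avoiding the former. -/
theorem exists_edge_towards_cycle (hH : H ∈ unicyclicClass V k n) (hC : H.IsCycle v e)
    (hw : w ∉ Set.range v) :
    ∃ (u : V) (e₀ h : Set V), u ≠ w ∧ e₀ ∈ E(H) ∧ w ∈ e₀ ∧ u ∈ e₀ ∧ h ∈ E(H) ∧ u ∈ h ∧ w ∉ h := by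
  by_contra hcon
  push Not at hcon
  have hU := hH.2.2.2
  have hm := hC.two_le
  -- If the claim fails, every edge through a neighbour of `w` contains `w`, so all vertices
  -- reachable from `w` are adjacent to it. Two consecutive cycle edges would then share `w` as well
  -- as a cycle vertex.
  have key : ∀ x, Relation.ReflTransGen H.Adj w x → x = w ∨ H.Adj w x := by
    intro x hx
    induction hx with
    | refl => exact Or.inl rfl
    | @tail y _ _ hab ih =>
      rcases ih with rfl | ⟨f, hf, hwf, haf⟩
      · exact Or.inr hab
      · obtain ⟨g, hg, hag, hbg⟩ := hab
        by_cases ha : y = w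
        · exact Or.inr ⟨g, hg, ha ▸ hag, hbg⟩
        · exact Or.inr ⟨g, hg, hcon _ f g ha hf hwf haf hg hag, hbg⟩
  set i : Fin m := ⟨0, by omega⟩
  set j := finRotate m i with hj
  have hvw : v j ≠ w := fun h => hw ⟨j, h⟩
  have hs : V(H) = Set.univ := hH.1
  rcases key (v j) (hU.1 w (by rw [hs]; trivial) _ (by rw [hs]; trivial)) with h | ⟨f, hf, hwf, hjf⟩
  · exact hvw h
  · have h1 := hcon _ f (e i) hvw hf hwf hjf (hC.edge_mem i) (hC.right_mem i)
    have h2 := hcon _ f (e j) hvw hf hwf hjf (hC.edge_mem j) (hC.left_mem j)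
    exact finRotate_ne hm i (hC.edge_injective (hU.edge_eq_of_notMem_range hC hw hvw
      (hC.edge_mem j) (hC.edge_mem i) h2 (hC.left_mem j) h1 (hC.right_mem i)))

/-- Counting incidences in two ways gives `|E| * k = n + |E|`, that is `|E| * (k - 1) = n`. -/
theorem four_le_ncard_edgeSet (hk : 2 ≤ k) (hn : 3 * (k - 1) < n)
    (hH : H ∈ unicyclicClass V k n) : 4 ≤ E(H).ncard := by
  have h1 := ncard_incidences_of_mem_unicyclicClass (by omega) (by omega) hH
  rw [ncard_incidences_of_isUniform hH.2.2.1, Nat.card_eq_fintype_card, hH.2.1] at h1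
  obtain ⟨j, rfl⟩ : ∃ j, k = j + 1 := ⟨k - 1, by omega⟩
  rw [Nat.add_sub_cancel] at hn
  by_contra hlt
  have : E(H).ncard * j ≤ 3 * j := Nat.mul_le_mul_right j (by omega)
  rw [Nat.mul_add, mul_one] at h1
  omega

/-- In a maximiser, vertices off the cycle lie in one edge only. -/
theorem eq_of_mem_of_maximal (hk : 2 ≤ k) (hn : 3 * (k - 1) < n)
    (hH : H ∈ unicyclicClass V k n)
    (hmax : ∀ G ∈ unicyclicClass V k n \ extremalClass V k n, G.estradaIndex ≤ H.estradaIndex)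
    (hC : H.IsCycle v e) (hw : w ∉ Set.range v) {a b : Set V} (ha : a ∈ E(H)) (hb : b ∈ E(H))
    (hwa : w ∈ a) (hwb : w ∈ b) : a = b := by
  by_contra hab
  have hU := hH.2.2.2
  have hn1 : 1 ≤ n := by omega
  have uniq : ∀ {x f g}, x ≠ w → f ∈ E(H) → g ∈ E(H) → w ∈ f → x ∈ f → w ∈ g → x ∈ g → f = g :=
    fun hx hf hg h1 h2 h3 h4 => hU.edge_eq_of_notMem_range hC hw hx hf hg h1 h2 h3 h4
  have ext : ∀ {G : Hypergraph V}, G ∈ unicyclicClass V k n → H.estradaIndex < G.estradaIndex →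
      G ∈ extremalClass V k n := by
    intro G hG hlt
    by_contra hX
    exact absurd hlt (hmax G ⟨hG, hX⟩).not_gt
  obtain ⟨u, e₀, h, huw, he₀, hwe, hue, hh, huh, hwh⟩ := exists_edge_towards_cycle hH hC hw
  obtain ⟨f₀, hf₀, hwf₀, hf₀e⟩ : ∃ f₀ ∈ E(H), w ∈ f₀ ∧ f₀ ≠ e₀ := by
    by_cases hae : a = e₀
    · exact ⟨b, hb, hwb, fun h => hab (hae.trans h.symm)⟩
    · exact ⟨a, ha, hwa, hae⟩
  have huf₀ : u ∉ f₀ := fun hu => hf₀e (uniq huw hf₀ he₀ hwf₀ hu hwe hue)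
  obtain ⟨hinj, hG, hlt⟩ := shift_adjacent hk hn1 hH hC hw huw he₀ hwe hue hf₀ hwf₀ huf₀ hh huh hwh
    rfl
  obtain ⟨c, f₁, f₂, huc, hcw, hf₁, hf₂, hf₁₂, huf₁, huf₂, hcf₁, hcf₂, hall, hc, hother⟩ :=
    exists_of_shift_mem_extremalClass hH hC hw huw he₀ hwe hue hf₀ hwf₀ huf₀ hh huh hwh rfl hinj
      (ext hG hlt)
  -- the case that the edge `e₀` lies on the cycle
  have onCycle : ∀ f₁ f₂ : Set V, f₁ ∈ E(H) → f₂ ∈ E(H) → f₁ ≠ f₂ → u ∈ f₁ → u ∈ f₂ → c ∈ f₁ →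
      c ∈ f₂ → (∀ a ∈ E(H), c ∈ a → a = f₁ ∨ a = f₂) → e₀ = f₁ → False := by
    rintro f₁ f₂ hf₁ hf₂ hf₁₂ huf₁ huf₂ hcf₁ hcf₂ hc he
    rw [he] at hwe hf₀e
    have hwf₂ : w ∉ f₂ := fun h => hf₁₂ (uniq huw hf₁ hf₂ hwe huf₁ h huf₂)
    have hcf₀ : c ∉ f₀ := fun h => hf₀e (uniq hcw hf₀ hf₁ hwf₀ h hwe hcf₁)
    -- Since `e₀ = f₁` also contains `c`, contraction towards `c` is possible too and must again
    -- give `Xₙ`; hence every edge contains `c` or `w`.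
    obtain ⟨hinj', hG', hlt'⟩ := shift_adjacent hk hn1 hH hC hw hcw hf₁ hwe hcf₁ hf₀ hwf₀ hcf₀ hf₂
      hcf₂ hwf₂ rfl
    obtain ⟨-, -, -, -, -, -, -, -, -, -, -, -, hall', -⟩ :=
      exists_of_shift_mem_extremalClass hH hC hw hcw hf₁ hwe hcf₁ hf₀ hwf₀ hcf₀ hf₂ hcf₂ hwf₂ rfl
        hinj' (ext hG' hlt')
    have hcard := four_le_ncard_edgeSet hk hn hH
    have hrest : 1 < (E(H) \ {f₁, f₂}).ncard := by
      have h1 := Set.ncard_sdiff_add_ncard_of_subset (s := ({f₁, f₂} : Set (Set V))) (t := E(H))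
        (by rintro x (rfl | rfl) <;> assumption)
      rw [Set.ncard_pair hf₁₂] at h1
      omega
    obtain ⟨g, g', hg, hg', hgg'⟩ := (Set.one_lt_ncard_iff (Set.toFinite _)).mp hrest
    have priv : ∀ x ∈ E(H) \ {f₁, f₂}, w ∈ x ∧ u ∉ x ∧ c ∉ x := by
      rintro x ⟨hx, hxf⟩
      have hcx : c ∉ x := fun h => hxf (hc x hx h)
      have hwx : w ∈ x := (hall' x hx).resolve_left hcx
      exact ⟨hwx, fun h => hxf (Or.inl (uniq huw hx hf₁ hwx h hwe huf₁)), hcx⟩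
    obtain ⟨hwg, hug, hcg⟩ := priv g hg
    obtain ⟨hwg', hug', hcg'⟩ := priv g' hg'
    have hgf₁ : f₁ ≠ g := fun h => hug (h ▸ huf₁)
    have hgf₂ : f₂ ≠ g := fun h => hug (h ▸ huf₂)
    -- At least two edges besides `f₁`, `f₂` hang at `w`. One of them, `g`, is left behind while the
    -- others move to `u`: then `u` lies in `f₁`, `f₂` and the moved `g'` but not in `g`, so the
    -- result is not `Xₙ`. The index rises by comparing `g` with `f₂`; the edge `f₁`, through `w`,
    -- `u` and `c`, provides strictness.
    set F : Set (Set V) := {f ∈ E(H) | f ≠ g ∧ w ∈ f ∧ u ∉ f} with hF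
    have hinj'' : Set.InjOn (moveEdge F w u) E(H) := by
      refine injOn_moveEdge (fun f hf => hf.2.2) ?_
      rintro f hf _ hx - rfl
      obtain ⟨x, hxf, hxw⟩ := hH.2.2.1.exists_mem_ne hk hf.1 w
      have hcf : c ∉ f := fun h => by
        rcases hc f hf.1 h with rfl | rfl
        exacts [hf.2.2.2 huf₁, hf.2.2.2 huf₂]
      have := hother x (fun h => hf.2.2.2 (h ▸ hxf)) (fun h => hcf (h ▸ hxf)) hxw f hf.1 _ hx hxf
        (Set.mem_insert_of_mem _ ⟨hxf, hxw⟩)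
      exact hf.2.2.2 (this ▸ Set.mem_insert u _)
    have hg'F : g' ∈ F := ⟨hg'.1, hgg'.symm, hwg', hug'⟩
    have hf₁F : f₁ ∉ F := fun h => h.2.2.2 huf₁
    have hf₂F : f₂ ∉ F := fun h => h.2.2.2 huf₂
    have hgF : g ∉ F := fun h => h.2.1 rfl
    have hG'' : H.shift F w u ∈ unicyclicClass V k n := by
      refine shift_mem_unicyclicClass (by omega) hn1 hH hC hw (fun f hf => hf.2.2) hinj''
        (Relation.ReflTransGen.single ⟨f₁, ?_, hwe, huf₁⟩)
      have := moveEdge_mem_shift (F := F) (w := w) (z := u) hf₁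
      rwa [moveEdge_of_notMem hf₁F] at this
    obtain ⟨o, ho, how⟩ := hH.2.2.1.exists_mem_ne hk hg'.1 w
    have hlt'' : H.estradaIndex < (H.shift F w u).estradaIndex := by
      refine estradaIndex_lt_shift_of_edges hg.1 hf₂
        ((hH.2.2.1 g hg.1).trans (hH.2.2.1 f₂ hf₂).symm) hwg hwf₂ huf₂ hug ?_ hF hinj'' hg'F ho how
        hf₁ hgf₁ hf₁₂ huf₁ (Or.inr ⟨hwe, c, hcf₁, hcf₂, hcg, huc.symm⟩)
      intro x hx hx₂ hxw f hf hxf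
      exact hother x (fun h => hug (h ▸ hx)) (fun h => hcg (h ▸ hx)) hxw f hf g hg.1 hxf hx
    have hcontra := mem_of_mem_extremalClass (ext hG'' hlt'') (x := u) (a := moveEdge F w u g)
      (moveEdge_mem_shift hf₁) (moveEdge_mem_shift hf₂)
      (moveEdge_mem_shift hg'.1) (hinj''.ne hf₁ hf₂ hf₁₂)
      (hinj''.ne hf₁ hg'.1 fun h => hug' (h ▸ huf₁)) (hinj''.ne hf₂ hg'.1 fun h => hug' (h ▸ huf₂))
      (by rwa [moveEdge_of_notMem hf₁F]) (by rwa [moveEdge_of_notMem hf₂F])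
      (by simp [mem_moveEdge_of_mem hg'F]) (moveEdge_mem_shift hg.1)
    rw [moveEdge_of_notMem hgF] at hcontra
    exact hug hcontra
  by_cases he₁ : e₀ = f₁
  · exact onCycle f₁ f₂ hf₁ hf₂ hf₁₂ huf₁ huf₂ hcf₁ hcf₂ hc he₁
  by_cases he₂ : e₀ = f₂
  · exact onCycle f₂ f₁ hf₂ hf₁ hf₁₂.symm huf₂ huf₁ hcf₂ hcf₁ (fun a ha h => (hc a ha h).symm) he₂
  -- the case that `e₀` is not an edge of the cycle
  have hce₀ : c ∉ e₀ := fun h => (hc e₀ he₀ h).elim he₁ he₂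
  have hwf₁ : w ∉ f₁ := fun h => he₁ (uniq huw he₀ hf₁ hwe hue h huf₁)
  have hwf₂ : w ∉ f₂ := fun h => he₂ (uniq huw he₀ hf₂ hwe hue h huf₂)
  -- Now the edges at `w` other than `e₀` jump to `c`, by comparing `e₀` with `f₁`; the edge `f₂`
  -- through `c` and `u` provides strictness. Afterwards `c` lies in three edges but not in `e₀`, so
  -- the result is not `Xₙ`.
  set F : Set (Set V) := {f ∈ E(H) | f ≠ e₀ ∧ w ∈ f ∧ c ∉ f} with hF
  have hcf₀ : c ∉ f₀ := fun h => by
    rcases hc f₀ hf₀ h with rfl | rfl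
    exacts [hwf₁ hwf₀, hwf₂ hwf₀]
  have hf₀F : f₀ ∈ F := ⟨hf₀, hf₀e, hwf₀, hcf₀⟩
  have hf₁F : f₁ ∉ F := fun h => hwf₁ h.2.2.1
  have hf₂F : f₂ ∉ F := fun h => hwf₂ h.2.2.1
  have he₀F : e₀ ∉ F := fun h => h.2.1 rfl
  have hinj' : Set.InjOn (moveEdge F w c) E(H) := by
    refine injOn_moveEdge (fun f hf => hf.2.2) ?_
    rintro f hf _ hx - rfl
    obtain ⟨x, hxf, hxw⟩ := hH.2.2.1.exists_mem_ne hk hf.1 w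
    have huf : u ∉ f := fun h => hf.2.1 (uniq huw hf.1 he₀ hf.2.2.1 h hwe hue)
    have := hother x (fun h => huf (h ▸ hxf)) (fun h => hf.2.2.2 (h ▸ hxf)) hxw f hf.1 _ hx hxf
      (Set.mem_insert_of_mem _ ⟨hxf, hxw⟩)
    exact hf.2.2.2 (this ▸ Set.mem_insert c _)
  have hfix : ∀ f ∈ E(H), f ∉ F → f ∈ E(H.shift F w c) := fun f hf hfF => by
    have := moveEdge_mem_shift (F := F) (w := w) (z := c) hf
    rwa [moveEdge_of_notMem hfF] at this
  have hG' : H.shift F w c ∈ unicyclicClass V k n :=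
    shift_mem_unicyclicClass (by omega) hn1 hH hC hw (fun f hf => hf.2.2) hinj'
      ((Relation.ReflTransGen.single ⟨e₀, hfix e₀ he₀ he₀F, hwe, hue⟩).tail
        ⟨f₁, hfix f₁ hf₁ hf₁F, huf₁, hcf₁⟩)
  obtain ⟨o, ho, how⟩ := hH.2.2.1.exists_mem_ne hk hf₀ w
  have hlt' : H.estradaIndex < (H.shift F w c).estradaIndex := by
    refine estradaIndex_lt_shift_of_edges he₀ hf₁
      ((hH.2.2.1 e₀ he₀).trans (hH.2.2.1 f₁ hf₁).symm) hwe hwf₁ hcf₁ hce₀ ?_ hF hinj' hf₀F ho how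
      hf₂ (Ne.symm he₂) hf₁₂.symm hcf₂ (Or.inl ⟨hwf₂, u, huf₂, huc, fun h => h.2 huf₁⟩)
    intro x hx hx₁ hxw f hf hxf
    exact hother x (fun h => hx₁ (h ▸ huf₁)) (fun h => hce₀ (h ▸ hx)) hxw f hf e₀ he₀ hxf hx
  have hcontra := mem_of_mem_extremalClass (ext hG' hlt') (x := c)
    (moveEdge_mem_shift hf₁) (moveEdge_mem_shift hf₂) (moveEdge_mem_shift hf₀)
    (hinj'.ne hf₁ hf₂ hf₁₂) (hinj'.ne hf₁ hf₀ fun h => hcf₀ (h ▸ hcf₁))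
    (hinj'.ne hf₂ hf₀ fun h => hcf₀ (h ▸ hcf₂))
    (by rwa [moveEdge_of_notMem hf₁F]) (by rwa [moveEdge_of_notMem hf₂F])
    (by simp [mem_moveEdge_of_mem hf₀F]) (hfix e₀ he₀ he₀F)
  exact hce₀ hcontra

end Branch

/-- A unicyclic hypergraph whose vertices off the cycle lie in one edge only is a cycle with
pendant edges attached at the vertices of the cycle. -/
theorem isCycleWithPendants_of_forall_eq {k n m : ℕ} {v : Fin m → V} {e : Fin m → Set V}
    (hk : 1 ≤ k) (hn : 1 ≤ n) (hH : H ∈ unicyclicClass V k n) (hC : H.IsCycle v e)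
    (h : ∀ w, w ∉ Set.range v → ∀ a ∈ E(H), ∀ b ∈ E(H), w ∈ a → w ∈ b → a = b) :
    H.IsCycleWithPendants k m fun i => {f ∈ E(H) | f ∉ Set.range e ∧ v i ∈ f}.ncard := by
  have hcon := incGraph_connected_of_mem_unicyclicClass hk hn hH
  have hcard := ncard_incidences_of_mem_unicyclicClass hk hn hH
  have hm := hC.two_le
  have hs : V(H) = Set.univ := hH.1
  have hreach : ∀ x y, Relation.ReflTransGen H.Adj x y := fun x y =>
    hH.2.2.2.1 x (by rw [hs]; trivial) y (by rw [hs]; trivial)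
  set i₀ : Fin m := ⟨0, by omega⟩
  refine ⟨hH.1, hH.2.2.1, v, e, hC, ?_, ?_, ?_, fun i => rfl⟩
  · intro i
    ext x
    constructor
    · rintro ⟨hx, j, rfl⟩
      obtain ⟨l, hl | hl⟩ := mem_cycleIncidences_of_mem hcon hcard hC hx
      all_goals
        obtain ⟨h1, h2⟩ := Prod.mk.inj hl
        obtain rfl := hC.edge_injective h2
        simp [h1]
    · rintro (rfl | rfl)
      exacts [⟨hC.left_mem i, _, rfl⟩, ⟨hC.right_mem i, _, rfl⟩]
  · intro f hf hfe
    obtain ⟨i, hi⟩ : ∃ i, v i ∈ f := by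
      by_contra hno
      push Not at hno
      obtain ⟨x, hx⟩ : f.Nonempty := by
        rw [← Set.ncard_pos, hH.2.2.1 f hf]
        omega
      -- If `f` misses the cycle, each of its vertices lies in no other edge, so no walk can leave
      -- `f`.
      have key : ∀ y, Relation.ReflTransGen H.Adj x y → y ∈ f := by
        intro y hy
        induction hy with
        | refl => exact hx
        | tail _ hab ih =>
          obtain ⟨g, hg, hag, hbg⟩ := hab
          rwa [h _ (by rintro ⟨i, rfl⟩; exact hno i ih) f hf g hg ih hag]
      exact hno i₀ (key _ (hreach _ _))
    refine ⟨i, Set.eq_singleton_iff_unique_mem.mpr ⟨⟨hi, i, rfl⟩, ?_⟩⟩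
    rintro _ ⟨hj, j, rfl⟩
    rw [eq_of_mem_of_notMem_range hcon hcard hC hf hfe hi hj]
  · intro x hx
    have hxv : x ≠ v i₀ := fun h => hx ⟨i₀, h.symm⟩
    obtain hxe | ⟨y, ⟨f, hf, hxf, -⟩, -⟩ := (hreach x (v i₀)).cases_head
    · exact absurd hxe hxv
    · refine Set.ncard_eq_one.mpr ⟨f, Set.eq_singleton_iff_unique_mem.mpr ⟨⟨hf, hxf⟩, ?_⟩⟩
      rintro g ⟨hg, hxg⟩
      exact h x hx g hg f hf hxg hxf

end Hypergraph

theorem theorem4p7 {V : Type*} [Fintype V] (k n : ℕ) (hk : 2 ≤ k) (hn : 3 * (k - 1) < n)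
    (G₀ : Hypergraph V)
    (hG₀ : G₀ ∈ Hypergraph.unicyclicClass V k n \ Hypergraph.extremalClass V k n)
    (hmax : ∀ G ∈ Hypergraph.unicyclicClass V k n \ Hypergraph.extremalClass V k n,
      G.estradaIndex ≤ G₀.estradaIndex) :
    ∃ m : ℕ, 2 ≤ m ∧
      G₀ ∈ Hypergraph.pendantClass V k m n \ Hypergraph.extremalClass V k n := by
  obtain ⟨hU, hX⟩ := hG₀
  obtain ⟨m, v, e, hC⟩ := hU.2.2.2.2.1
  refine ⟨m, hC.two_le, ⟨hU, _,
    Hypergraph.isCycleWithPendants_of_forall_eq (by omega) (by omega) hU hC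
      fun w hw a ha b hb hwa hwb =>
        Hypergraph.eq_of_mem_of_maximal hk hn hU hmax hC hw ha hb hwa hwb⟩, hX⟩
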